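/- **Setting.** Let $V=V_0\uplus V_1$ be a finite set of $n$ vertices, $E\subseteq V\times V$ an edge relation such that every vertex has at least one successor, and $E^\ell\subseteq E\cap(V_1\times V)$ a set of live edges. A strategy of Player $i$ is a function $\rho_i:V^*\cdot V_i\to V$ with $\rho_i(w\cdot v)\in E(v)$; it is memoryless if $\rho_i(w\cdot v)$ depends on $v$ only. A play $\pi=v^0v^1\dots$ is fair if for every $(v,v')\in E^\ell$ the following holds: if $v$ occurs infinitely often in $\pi$, then $v$ is followed by $v'$ infinitely often. Let $(G_1,R_1),\dots,(G_k,R_k)$, $k\ge 0$, be pairs of subsets of $V$ with $G_1\supseteq\dots\supseteq G_k$ and $R_1\supseteq\dots\supseteq R_k$ (a Rabin chain condition). Player 0 wins the fair adversarial game from $v$ if she has a strategy such that every play from $v$ that is compliant with it and with some strategy of Player 1 satisfies: if the play is fair, then for some $j\in[1;k]$ it visits $R_j$ only finitely often and $G_j$ infinitely often. Her winning region $\mathcal W$ is the set of all such $v$. For $S,T\subseteq V$ let $$\mathrm{Pre}^\forall_1(S)=\{v\in V_1: E(v)\subseteq S\},\quad \mathrm{Cpre}(S)=\{v\in V_0: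 E(v)\cap S\ne\emptyset\}\cup\mathrm{Pre}^\forall_1(S),$$ $$\mathrm{Lpre}^\exists(T)=\{v: E^\ell(v)\cap T\neq\emptyset\},\quad \mathrm{Apre}(S,T)=\mathrm{Cpre}(T)\cup(\mathrm{Lpre}^\exists(T)\cap\mathrm{Pre}^\forall_1(S)),$$ and put $G_0=R_0=\emptyset$. **Theorem.** Let $$Z^*=\nu Y_0.\,\mu X_0.\,\nu Y_k.\,\mu X_k.\,\nu Y_{k-1}.\,\mu X_{k-1}\cdots\nu Y_1.\,\mu X_1.\ \bigcup_{j=0}^k \overline{R_j}\cap\big[(G_j\cap \mathrm{Cpre}(Y_j))\cup\mathrm{Apre}(Y_j,X_j)\big].$$ 1. With $P=[1;k]$ and $p_0=0$, $Z^*$ equals the permutation-indexed Rabin fixpoint $$\nu Y_{0}.\,\mu X_{0}.\bigcup_{p_1\in P}\nu Y_{p_1}.\,\mu X_{p_1}.\bigcup_{p_2\in P\setminus\{p_1\}}\nu Y_{p_2}.\,\mu X_{p_2}\cdots\bigcup_{p_k\in P\setminus\{p_1,\dots,p_{k-1}\}}\nu Y_{p_k}.\,\mu X_{p_k}.\ \bigcup_{j=0}^k\Big(\bigcap_{i=0}^j\overline{R_{p_i}}\Big)\cap\big[(G_{p_j}\cap\mathrm{Cpre}(Y_{p_j}))\cup\mathrm{Apre}(Y_{p_j},X_{p_j})\big].$$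 2. $Z^*=\mathcal W$. 3. Evaluate $Z^*$ by nested iteration: every $\mu$-iteration starts from $\emptyset$; every $\nu$-iteration starts from the last value computed for its variable at the same iteration counters of the enclosing $\mu$-iterations, and from $V$ if there is none. This accelerated fixpoint algorithm computes $Z^*$, and for fixed $k$ it makes $O(n^{k+2})$ symbolic steps (predecessor operations, Boolean set operations and comparisons of sets): there is a constant $C$ depending only on $k$ such that it makes at most $C\,n^{k+2}$ steps whenever $n\ge1$. 4. A memoryless winning strategy can be extracted from the fixpoint. Give each $v\in Z^*$ as its rank the lexicographically least tuple $(i_0,i_k,i_{k-1},\dots,i_1)$ of natural numbers such that $v$ lies in $\bigcup_{j=0}^k \overline{R_j}\cap[(G_j\cap \mathrm{Cpre}(Y_j))\cup\mathrm{Apre}(Y_j,X_j)]$ when, from outside to inside, each $Y_j$ has its fixpoint value and each $X_j$ is the $i_j$-th iterate, starting from $\emptyset$, of its fixpoint iteration. Memoryless Player 0 strategies that move, from every vertex of $V_0\cap Z^*$, to a successor of least rank exist (successors outside $Z^*$ have no rank and are never chosen), and each of them wins the fair adversarial game from every vertex of $Z^*$. -/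

import Mathlib

open Filter

noncomputable section

namespace FairGame

/-- A two-player game graph with live edges on the vertex set `V`.  Player 0 owns the vertices in
`V0`, player 1 owns all the others; `E` is the edge relation, and the live edges `El` are edges
that leave vertices of player 1. -/
structure LiveGame (V : Type*) where
  V0 : Set V
  E : V → V → Prop
  El : V → V → Prop
  El_owner : ∀ v w, El v w → v ∉ V0
  El_edge : ∀ v w, El v w → E v w

namespace LiveGame

variable {V : Type*} (A : LiveGame V)

/-- The vertices of player 1. -/
def V1 : Set V := A.V0ᶜ

/-- No vertex is a dead end. -/
def NoDeadEnd : Prop := ∀ v, ∃ w, A.E v w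

/-! ### Strategies, plays, winning regions -/

/-- A strategy of the player who owns the vertices in `O`: given the past `w` (a finite word) and
the current vertex `v ∈ O`, it picks a successor of `v`. -/
structure Strategy (O : Set V) where
  move : List V → O → V
  legal : ∀ w (v : O), A.E v (move w v)

variable {A} in
/-- The move depends on the current vertex only. -/
def Strategy.Memoryless {O : Set V} (ρ : A.Strategy O) : Prop :=
  ∀ w₁ w₂ v, ρ.move w₁ v = ρ.move w₂ v

/-- The infinite sequence `π` is compliant with the strategies `ρ₀` and `ρ₁`.  The list
`(List.range i).map π` is the past `π 0, …, π (i - 1)`. -/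
def Compliant (ρ₀ : A.Strategy A.V0) (ρ₁ : A.Strategy A.V1) (π : ℕ → V) : Prop :=
  ∀ i, (∀ h : π i ∈ A.V0, π (i + 1) = ρ₀.move ((List.range i).map π) ⟨π i, h⟩) ∧
    (∀ h : π i ∈ A.V1, π (i + 1) = ρ₁.move ((List.range i).map π) ⟨π i, h⟩)

/-- With the strategy `ρ₀`, player 0 wins from `v` for the winning condition `φ`. -/
def WinsWith (φ : Set (ℕ → V)) (ρ₀ : A.Strategy A.V0) (v : V) : Prop :=
  ∀ ρ₁ : A.Strategy A.V1, ∀ π : ℕ → V, π 0 = v → A.Compliant ρ₀ ρ₁ π → π ∈ φ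

/-- The winning region of player 0 for the winning condition `φ`. -/
def winningRegion (φ : Set (ℕ → V)) : Set V :=
  {v | ∃ ρ₀ : A.Strategy A.V0, A.WinsWith φ ρ₀ v}

/-- Strong transition fairness: if the source of a live edge is visited infinitely often, then the
edge is taken infinitely often. -/
def fair : Set (ℕ → V) :=
  {π | ∀ v w, A.El v w → (∃ᶠ i in atTop, π i = v) → ∃ᶠ i in atTop, π i = v ∧ π (i + 1) = w}

/-- The condition that player 0 has to ensure in the fair adversarial game for `φ`. -/
def fairAdversarial (φ : Set (ℕ → V)) : Set (ℕ → V) :=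
  {π | π ∈ A.fair → π ∈ φ}

/-! ### Set transformers -/

/-- Controllable predecessor. -/
def cpre (S : Set V) : Set V :=
  {v | v ∈ A.V0 ∧ ∃ w, A.E v w ∧ w ∈ S} ∪ {v | v ∈ A.V1 ∧ ∀ w, A.E v w → w ∈ S}

/-- Universal predecessor of player 1. -/
def preForall (S : Set V) : Set V := {v | v ∈ A.V1 ∧ ∀ w, A.E v w → w ∈ S}

/-- Live-existential predecessor. -/
def lpre (S : Set V) : Set V := {v | ∃ w, A.El v w ∧ w ∈ S}

/-- Almost sure predecessor. -/
def apre (S T : Set V) : Set V := A.cpre T ∪ (A.lpre T ∩ A.preForall S)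

theorem cpre_mono {S S' : Set V} (h : S ⊆ S') : A.cpre S ⊆ A.cpre S' := by
  rintro v (⟨h0, w, hw, hs⟩ | ⟨h1, hw⟩)
  · exact Or.inl ⟨h0, w, hw, h hs⟩
  · exact Or.inr ⟨h1, fun w e => h (hw w e)⟩

theorem apre_mono {S S' T T' : Set V} (h : S ⊆ S') (h' : T ⊆ T') :
    A.apre S T ⊆ A.apre S' T' := by
  rintro v (hv | ⟨⟨w, hw, ht⟩, h1, hs⟩)
  · exact Or.inl (A.cpre_mono h' hv)
  · exact Or.inr ⟨⟨w, hw, h' ht⟩, h1, fun w e => h (hs w e)⟩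

end LiveGame

/-! ### Rabin conditions -/

variable {V : Type*} {k : ℕ}

/-- The Rabin condition with the pairs `(G j, R j)`: for some `j`, the set `R j` is visited only
finitely often and `G j` is visited infinitely often.  (The index `j : Fin k` counts from `0`.) -/
def rabin (G R : Fin k → Set V) : Set (ℕ → V) :=
  {π | ∃ j, (∀ᶠ i in atTop, π i ∉ R j) ∧ ∃ᶠ i in atTop, π i ∈ G j}

/-- The family with the artificial set `∅` put in front: index `0` is artificial, and the indices
`1, …, k` are those of the `k` given sets. -/
def ext (G : Fin k → Set V) : Fin (k + 1) → Set V := Fin.cons ∅ G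

/-! ### Fixpoint expressions -/

/-- Values of the variables `Y_j` (first component) and `X_j` (second component), `j = 0, …, k`. -/
abbrev Val (k : ℕ) (V : Type*) := (Fin (k + 1) → Set V) × (Fin (k + 1) → Set V)

/-- Set `Y_j` to `S` and `X_j` to `T`. -/
def Val.set (p : Val k V) (j : Fin (k + 1)) (S T : Set V) : Val k V :=
  (Function.update p.1 j S, Function.update p.2 j T)

theorem Val.set_mono {p q : Val k V} (h : p ≤ q) (j : Fin (k + 1)) {S S' T T' : Set V}
    (hS : S ≤ S') (hT : T ≤ T') : p.set j S T ≤ q.set j S' T' := by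
  constructor
  · exact update_le_update_iff.2 ⟨hS, fun i _ => h.1 i⟩
  · exact update_le_update_iff.2 ⟨hT, fun i _ => h.2 i⟩

/-- `ν Y_j. μ X_j. f`, as a function of the values of the other variables. -/
def nuMu (j : Fin (k + 1)) (f : Val k V →o Set V) : Val k V →o Set V where
  toFun p := OrderHom.gfp
    { toFun := fun S => OrderHom.lfp
        { toFun := fun T => f (p.set j S T)
          monotone' := fun _ _ hT => f.monotone (Val.set_mono le_rfl j le_rfl hT) }
      monotone' := fun _ _ hS => OrderHom.lfp.monotone
        fun _ => f.monotone (Val.set_mono le_rfl j hS le_rfl) }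
  monotone' := fun _ _ h => OrderHom.gfp.monotone fun _ => OrderHom.lfp.monotone
    fun _ => f.monotone (Val.set_mono h j le_rfl le_rfl)

variable (A : LiveGame V) (G R : Fin k → Set V)

/-- `(G_j ∩ Cpre(Y_j)) ∪ Apre(Y_j, X_j)`. -/
def core (j : Fin (k + 1)) (p : Val k V) : Set V :=
  (ext G j ∩ A.cpre (p.1 j)) ∪ A.apre (p.1 j) (p.2 j)

theorem core_mono (j : Fin (k + 1)) {p q : Val k V} (h : p ≤ q) :
    core A G j p ⊆ core A G j q :=
  Set.union_subset_union (Set.inter_subset_inter_right _ (A.cpre_mono (h.1 j)))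
    (A.apre_mono (h.1 j) (h.2 j))

/-- The body of the chain fixpoint: the union over `j = 0, …, k` of
`(complement of R_j) ∩ [(G_j ∩ Cpre(Y_j)) ∪ Apre(Y_j, X_j)]`. -/
def chainBody : Val k V →o Set V where
  toFun p := ⋃ j, (ext R j)ᶜ ∩ core A G j p
  monotone' := fun _ _ h => Set.iUnion_mono fun j =>
    Set.inter_subset_inter_right _ (core_mono A G j h)

/-- The order `0, k, k - 1, …, 1` in which the chain fixpoint binds its variables. -/
def chainOrder (k : ℕ) : List (Fin (k + 1)) := 0 :: (List.finRange k).reverse.map Fin.succ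

/-- `ν Y_{j₁}. μ X_{j₁}. ν Y_{j₂}. μ X_{j₂}. … (chain body)` for a list `j₁, j₂, …` of indices. -/
def nested (js : List (Fin (k + 1))) : Val k V →o Set V := js.foldr nuMu (chainBody A G R)

/-- `ν Y_0. μ X_0. ν Y_k. μ X_k. … ν Y_1. μ X_1. (chain body)`.  All variables are bound, so the
values at which the expression is evaluated do not matter. -/
def chainFixpoint : Set V := nested A G R (chainOrder k) ⊥

/-- The body of the Rabin fixpoint for a sequence `δ = p_0 p_1 …` of indices: the union over `j` of
`(⋂ i ≤ j, complement of R_{p_i}) ∩ [(G_{p_j} ∩ Cpre(Y_{p_j})) ∪ Apre(Y_{p_j}, X_{p_j})]`. -/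
def rabinBody (δ : List (Fin (k + 1))) : Val k V →o Set V where
  toFun p := ⋃ j : Fin δ.length,
    (⋂ i : Fin δ.length, ⋂ _ : i ≤ j, (ext R (δ.get i))ᶜ) ∩ core A G (δ.get j) p
  monotone' := fun _ _ h => Set.iUnion_mono fun _ =>
    Set.inter_subset_inter_right _ (core_mono A G _ h)

/-- The part of the Rabin fixpoint below the sequence `δ` of indices chosen so far, if `m` more
indices have to be chosen: `⋃ q ∉ δ, ν Y_q. μ X_q. ⋃ q' ∉ δ q, ν Y_{q'}. μ X_{q'}. …`. -/
def rabinNested : ℕ → List (Fin (k + 1)) → (Val k V →o Set V)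
  | 0, δ => rabinBody A G R δ
  | m + 1, δ => ⨆ q : Fin (k + 1), ⨆ _ : q ∉ δ, nuMu q (rabinNested m (δ ++ [q]))

/-- The permutation-indexed Rabin fixpoint
`ν Y_0. μ X_0. ⋃ p_1. ν Y_{p_1}. μ X_{p_1}. … ⋃ p_k. ν Y_{p_k}. μ X_{p_k}. (Rabin body)`. -/
def rabinFixpoint : Set V := nuMu 0 (rabinNested A G R k [0]) ⊥

/-! ### Evaluation of the chain fixpoint with a count of symbolic steps

The fixpoints are evaluated by iteration.  Every `μ`-iteration starts from `∅`.  A `ν`-iteration is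
warm-started from the last value that was computed for the same variable at the same iteration
counters of the enclosing `μ`-iterations, and from the set of all vertices if there is none. -/

/-- The state of the evaluation: `cache c` is the initial value of the next `ν`-iteration that is
enclosed by `μ`-iterations with the counters `c` (outermost first; the length of `c` determines
the variable), and `steps` counts the symbolic steps made so far. -/
structure EvalState (V : Type*) where
  cache : List ℕ → Set V
  steps : ℕ

/-- Computations with the evaluation state. -/
abbrev Eval (V : Type*) := StateM (EvalState V)

/-- Count one symbolic step. -/
def tick : Eval V PUnit := fun s => (⟨⟩, { s with steps := s.steps + 1 })

/-- One set operation, with result `S`: one symbolic step. -/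
def setStep (S : Set V) : Eval V (Set V) := do
  tick
  pure S

/-- Read the cache. -/
def readCache (c : List ℕ) : Eval V (Set V) := fun s => (s.cache c, s)

/-- Write the cache. -/
def writeCache (c : List ℕ) (S : Set V) : Eval V PUnit :=
  fun s => (⟨⟩, { s with cache := Function.update s.cache c S })

/-- Evaluation of the terms of the chain body with indices in a list, operation by operation. -/
def evalBody (p : Val k V) : List (Fin (k + 1)) → Eval V (Set V)
  | [] => pure ∅
  | j :: js => do
    let c ← setStep (A.cpre (p.1 j))
    let g ← setStep (ext G j ∩ c)
    let x ← setStep (A.cpre (p.2 j))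
    let l ← setStep (A.lpre (p.2 j))
    let y ← setStep (A.preForall (p.1 j))
    let ly ← setStep (l ∩ y)
    let a ← setStep (x ∪ ly)
    let u ← setStep (g ∪ a)
    let r ← setStep ((ext R j)ᶜ)
    let t ← setStep (r ∩ u)
    let rest ← evalBody p js
    setStep (t ∪ rest)

open Classical in
/-- Repeat `S ↦ f i S` for `i, i + 1, …` until the value is stable, for at most as many rounds as
the first numerical argument says.  The comparison of two successive values is a symbolic step. -/
def iterate (f : ℕ → Set V → Eval V (Set V)) : ℕ → ℕ → Set V → Eval V (Set V)
  | 0, _, S => pure S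
  | m + 1, i, S => do
    let S' ← f i S
    tick
    if S' = S then pure S else iterate f m (i + 1) S'

/-- Evaluation of `ν Y_{j₁}. μ X_{j₁}. ν Y_{j₂}. μ X_{j₂}. … (chain body)` at the values `p` of the
variables, inside `μ`-iterations with the counters `c`.  On `n` vertices a monotone iteration is
stable after at most `n + 1` rounds. -/
def evalNested [Fintype V] : List (Fin (k + 1)) → List ℕ → Val k V → Eval V (Set V)
  | [], _, p => evalBody A G R p (List.finRange (k + 1))
  | j :: js, c, p => do
    let S₀ ← readCache c
    let S ← iterate
      (fun _ S => iterate (fun i T => evalNested js (c ++ [i]) (p.set j S T))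
        (Fintype.card V + 1) 0 ∅)
      (Fintype.card V + 1) 0 S₀
    writeCache c S
    pure S

/-- The accelerated fixpoint algorithm for the chain fixpoint: its result and its number of
symbolic steps. -/
def algorithm [Fintype V] : Set V × ℕ :=
  let out := (evalNested A G R (chainOrder k) [] ⊥).run { cache := fun _ => Set.univ, steps := 0 }
  (out.1, out.2.steps)

/-! ### Strategy extraction -/

/-- The vertices in the body of `ν Y_{j₁}. μ X_{j₁}. ν Y_{j₂}. μ X_{j₂}. … (chain body)` at the
counters `i₁, i₂, …`: every `Y` has the value of its fixpoint, and `X_{j₁}, X_{j₂}, …` are the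
iterates number `i₁, i₂, …` of their fixpoint iterations from `∅`. -/
def stage : List (Fin (k + 1)) → List ℕ → Val k V → Set V
  | [], _, p => chainBody A G R p
  | _ :: _, [], _ => ∅
  | j :: js, i :: c, p =>
    let Y := nested A G R (j :: js) p
    let X := (fun T => nested A G R js (p.set j Y T))^[i] ∅
    stage js c (p.set j Y X)

/-- `v` enters the chain fixpoint at the counters `c = i_0 i_k i_{k-1} … i_1`. -/
def HasConfig (v : V) (c : List ℕ) : Prop :=
  c.length = k + 1 ∧ v ∈ stage A G R (chainOrder k) c ⊥

/-- `ρ` is read off the chain fixpoint: from its vertices, player 0 moves to a successor whose rank,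
which is its lexicographically least sequence of counters, is least among all successors. -/
def Extracted (ρ : A.Strategy A.V0) : Prop :=
  ∀ w, ∀ v : A.V0, (v : V) ∈ chainFixpoint A G R →
    ∃ c, HasConfig A G R (ρ.move w v) c ∧
      ∀ u c', A.E v u → HasConfig A G R u c' → c ≤ c'

end FairGame

end

noncomputable section

namespace FairGame

variable {V : Type*} {k : ℕ}

/-! ### Unfolding of the fixpoints -/

/-! Along the binding order `0, k, …, 1` the sets `ext G` and `ext R` grow. The chain expression is
therefore one branch of the permutation expression: avoiding one `R_j` already avoids every `R_i`
bound further out. Conversely, suppose a permutation picks `q` after some `r` with `G_q ⊆ G_r`. The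
term of `q` also demands avoidance of `R_r`, and `Y_q`, `X_q` can be kept below `Y_r`, `X_r`, so the
term of `r` absorbs it. Only the record indices survive, and they form a subsequence of the chain
order (`rabinNested_le_nested`).

Inside `Z*`, ranks count `μ`-iterations. By `rank_step`, every vertex has a position `J` whose `R`
it avoids, where the first `J` counters need not grow and, outside `G`, the first `J + 1` counters
drop on the next move or along some live edge. On a fair play, consider the outermost position that
recurs. If its `G` were missed there, the counters up to it would reach a minimum from which this
position could never occur again.

Outside `Z*`, dual ranks count `ν`-iterations, and `corank_step` applies to every `J` whose `R` is
avoided. Player 1 can keep the counters up to `J` from growing and make them drop at `G`,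
simultaneously for all such `J` (`exists_default_move`). Fairness may force live edges that spoil
this; they are taken only after visits to a set `D v` inside each `R_J` whose counters they could
spoil. If `R_J` is visited finitely often, they stop interfering with `J`, and `G` is then seen only
finitely often.

The algorithm is correct because iterates with equal `μ`-counters shrink when the enclosing `Y`
shrink, so cached values remain valid upper starting points (`WarmStart.anti`). Each unstable
`ν`-round removes a vertex from a cached set; a potential summing the sizes of these sets, weighted
by the cost of a round, gives the step bound. -/

/-- `T ↦ f` with `Y_j = S` and `X_j = T`. -/
def innerHom (j : Fin (k + 1)) (f : Val k V →o Set V) (p : Val k V) (S : Set V) :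
    Set V →o Set V where
  toFun T := f (p.set j S T)
  monotone' _ _ hT := f.monotone (Val.set_mono le_rfl j le_rfl hT)

/-- `S ↦ μ X_j. f` with `Y_j = S`. -/
def outerHom (j : Fin (k + 1)) (f : Val k V →o Set V) (p : Val k V) : Set V →o Set V where
  toFun S := (innerHom j f p S).lfp
  monotone' _ _ hS := OrderHom.lfp.monotone fun _ => f.monotone (Val.set_mono le_rfl j hS le_rfl)

theorem nuMu_eq (j : Fin (k + 1)) (f : Val k V →o Set V) (p : Val k V) :
    nuMu j f p = (outerHom j f p).gfp := rfl

theorem innerHom_mono (j : Fin (k + 1)) (f : Val k V →o Set V) {p q : Val k V} (h : p ≤ q)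
    {S S' : Set V} (hS : S ≤ S') : innerHom j f p S ≤ innerHom j f q S' :=
  fun _ => f.monotone (Val.set_mono h j hS le_rfl)

theorem outerHom_mono (j : Fin (k + 1)) (f : Val k V →o Set V) {p q : Val k V} (h : p ≤ q) :
    outerHom j f p ≤ outerHom j f q :=
  fun _ => OrderHom.lfp.monotone (innerHom_mono j f h le_rfl)

theorem map_outerHom (j : Fin (k + 1)) (f : Val k V →o Set V) (p : Val k V) (S : Set V) :
    f (p.set j S (outerHom j f p S)) = outerHom j f p S :=
  (innerHom j f p S).map_lfp

theorem map_nuMu (j : Fin (k + 1)) (f : Val k V →o Set V) (p : Val k V) :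
    f (p.set j (nuMu j f p) (nuMu j f p)) = nuMu j f p := by
  have h : outerHom j f p (nuMu j f p) = nuMu j f p := (outerHom j f p).map_gfp
  conv_rhs => rw [← h, ← map_outerHom, h]

/-- The finite iterates of a monotone map from `∅`, in increasing order. -/
theorem iterate_empty_mono (g : Set V →o Set V) : Monotone fun i => g^[i] ∅ :=
  g.monotone.monotone_iterate_of_le_map (Set.empty_subset _)

theorem iterate_empty_le_lfp (g : Set V →o Set V) (i : ℕ) : g^[i] ∅ ≤ g.lfp := by
  induction i with
  | zero => exact Set.empty_subset _
  | succ i ih =>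
    rw [Function.iterate_succ_apply', ← g.map_lfp]
    exact g.monotone ih

theorem iterate_mono_of_le {g h : Set V →o Set V} (hgh : g ≤ h) (i : ℕ) :
    g^[i] ∅ ≤ h^[i] ∅ := by
  induction i with
  | zero => exact le_rfl
  | succ i ih =>
    rw [Function.iterate_succ_apply', Function.iterate_succ_apply']
    exact (g.monotone ih).trans (hgh _)

theorem iterate_eq_lfp {g : Set V →o Set V} {i : ℕ} (h : g (g^[i] ∅) = g^[i] ∅) :
    g^[i] ∅ = g.lfp :=
  le_antisymm (iterate_empty_le_lfp g i) (g.lfp_le h.le)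

/-! ### Generic loops -/

theorem iterate_succ_run (f : ℕ → Set V → Eval V (Set V)) (m i : ℕ) (S : Set V)
    (s : EvalState V) :
    iterate f (m + 1) i S s =
      if (f i S s).1 = S then (S, { (f i S s).2 with steps := (f i S s).2.steps + 1 })
      else iterate f m (i + 1) (f i S s).1
        { (f i S s).2 with steps := (f i S s).2.steps + 1 } := by
  change (if (f i S s).1 = S then pure S else iterate f m (i + 1) (f i S s).1 : Eval V (Set V))
    { (f i S s).2 with steps := (f i S s).2.steps + 1 } = _
  split_ifs <;> rfl

section Loops

variable [Fintype V] (Ψ : (List ℕ → Set V) → ℕ)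

/-- Every unstable round adds a vertex, so iterate number `i` has at least `i` elements and
stability comes before the rounds run out. Costs are amortized against `Ψ`; the extra `1` per round
pays for the comparison. -/
theorem iterate_mu_aux {g : Set V →o Set V} {f : ℕ → Set V → Eval V (Set V)}
    {I : (List ℕ → Set V) → Prop} {a : ℕ}
    (hf : ∀ i < Fintype.card V + 1, ∀ s : EvalState V, I s.cache →
      (f i (g^[i] ∅) s).1 = g (g^[i] ∅) ∧ I (f i (g^[i] ∅) s).2.cache ∧
      (f i (g^[i] ∅) s).2.steps + Ψ (f i (g^[i] ∅) s).2.cache ≤ s.steps + Ψ s.cache + a) :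
    ∀ (m i : ℕ) (s : EvalState V), I s.cache → i + m = Fintype.card V + 1 →
      i ≤ (g^[i] ∅).ncard →
      (iterate f m i (g^[i] ∅) s).1 = g.lfp ∧ I (iterate f m i (g^[i] ∅) s).2.cache ∧
      (iterate f m i (g^[i] ∅) s).2.steps + Ψ (iterate f m i (g^[i] ∅) s).2.cache ≤
        s.steps + Ψ s.cache + m * (a + 1) := by
  intro m
  induction m with
  | zero =>
    intro i s _ him hi
    -- With no rounds left, the iterate would have more elements than `V`.
    have := Set.ncard_le_card (g^[i] ∅)
    rw [Nat.card_eq_fintype_card] at this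
    omega
  | succ m ih =>
    intro i s hI him hi
    obtain ⟨h1, h2, h3⟩ := hf i (by omega) s hI
    rw [iterate_succ_run]
    rw [h1]
    split_ifs with h
    · refine ⟨iterate_eq_lfp h, h2, ?_⟩
      simp only
      nlinarith [Nat.zero_le (m * (a + 1))]
    · have hlt : (g^[i] ∅).ncard < (g^[i + 1] ∅).ncard := by
        refine Set.ncard_lt_ncard (lt_of_le_of_ne (iterate_empty_mono g i.le_succ) fun he => h ?_)
          (Set.toFinite _)
        rw [← Function.iterate_succ_apply' g i, ← Nat.succ_eq_add_one] at *
        exact he.symm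
      have := ih (i + 1) { (f i (g^[i] ∅) s).2 with steps := (f i (g^[i] ∅) s).2.steps + 1 }
        h2 (by omega) (by omega)
      rw [Function.iterate_succ_apply' g i] at this
      refine ⟨this.1, this.2.1, this.2.2.trans ?_⟩
      simp only
      nlinarith

theorem iterate_mu {g : Set V →o Set V} {f : ℕ → Set V → Eval V (Set V)}
    {I : (List ℕ → Set V) → Prop} {a : ℕ}
    (hf : ∀ i < Fintype.card V + 1, ∀ s : EvalState V, I s.cache →
      (f i (g^[i] ∅) s).1 = g (g^[i] ∅) ∧ I (f i (g^[i] ∅) s).2.cache ∧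
      (f i (g^[i] ∅) s).2.steps + Ψ (f i (g^[i] ∅) s).2.cache ≤ s.steps + Ψ s.cache + a)
    (s : EvalState V) (hs : I s.cache) :
    (iterate f (Fintype.card V + 1) 0 ∅ s).1 = g.lfp ∧
      I (iterate f (Fintype.card V + 1) 0 ∅ s).2.cache ∧
      (iterate f (Fintype.card V + 1) 0 ∅ s).2.steps +
          Ψ (iterate f (Fintype.card V + 1) 0 ∅ s).2.cache ≤
        s.steps + Ψ s.cache + (Fintype.card V + 1) * (a + 1) :=
  iterate_mu_aux Ψ hf _ 0 s hs (by omega) (by simp)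

/-- Each unstable round costs `b + 1` and is paid for by a vertex that leaves `S`; the final, stable
round is the additional `1`. Starting from any `S` above the greatest fixpoint with `F S ≤ S` is
enough, and `hI` carries the invariant to the smaller set. -/
theorem iterate_nu {F : Set V →o Set V} {f : Set V → Eval V (Set V)}
    {I : Set V → (List ℕ → Set V) → Prop} {b : ℕ}
    (hI : ∀ S S' κ, S' ≤ S → I S κ → I S' κ)
    (hf : ∀ S, ∀ s : EvalState V, I S s.cache →
      (f S s).1 = F S ∧ I S (f S s).2.cache ∧
      (f S s).2.steps + Ψ (f S s).2.cache ≤ s.steps + Ψ s.cache + b) :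
    ∀ (m i : ℕ) (S : Set V) (s : EvalState V), I S s.cache → F.gfp ≤ S → F S ≤ S →
      S.ncard < m →
      (iterate (fun _ => f) m i S s).1 = F.gfp ∧
      I F.gfp (iterate (fun _ => f) m i S s).2.cache ∧
      (iterate (fun _ => f) m i S s).2.steps + Ψ (iterate (fun _ => f) m i S s).2.cache +
          (b + 1) * F.gfp.ncard ≤ s.steps + Ψ s.cache + (b + 1) * (1 + S.ncard) := by
  intro m
  induction m with
  | zero => intro i S s _ _ _ h; omega
  | succ m ih =>
    intro i S s hs hS hFS hm
    obtain ⟨h1, h2, h3⟩ := hf S s hs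
    rw [iterate_succ_run, h1]
    split_ifs with h
    · have he : S = F.gfp := le_antisymm (F.le_gfp h.ge) hS
      refine ⟨he, he ▸ h2, ?_⟩
      rw [← he]
      simp only
      nlinarith
    · have hlt : (F S).ncard < S.ncard :=
        Set.ncard_lt_ncard (lt_of_le_of_ne hFS h) (Set.toFinite _)
      obtain ⟨i1, i2, i3⟩ := ih (i + 1) (F S)
        { (f S s).2 with steps := (f S s).2.steps + 1 } (hI _ _ _ hFS h2)
        (by rw [← F.map_gfp]; exact F.monotone hS) (F.monotone hFS) (by omega)
      refine ⟨i1, i2, i3.trans ?_⟩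
      simp only
      have : (b + 1) * (1 + (F S).ncard) ≤ (b + 1) * S.ncard := Nat.mul_le_mul_left _ (by omega)
      nlinarith

end Loops

/-! ### The accelerated algorithm -/

section Algorithm

variable (A : LiveGame V) (G R : Fin k → Set V)

/-- The cache may be used to start the evaluation of `ν Y_{j₁}. μ X_{j₁}. …` at the values `p`,
inside `μ`-iterations with the counters `c`. -/
def WarmStart : List (Fin (k + 1)) → List ℕ → Val k V → (List ℕ → Set V) → Prop
  | [], _, _, _ => True
  | j :: js, c, p, κ =>
    nested A G R (j :: js) p ≤ κ c ∧ outerHom j (nested A G R js) p (κ c) ≤ κ c ∧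
      ∀ i, WarmStart js (c ++ [i])
        (p.set j (κ c) ((innerHom j (nested A G R js) p (κ c))^[i] ∅)) κ

variable {A G R}

/-- This justifies reusing the cache: lowering the outer values lowers the greatest fixpoint and the
operator, and also each inner `μ`-iterate with a fixed number, so both inequalities persist at every
depth. -/
theorem WarmStart.anti {js : List (Fin (k + 1))} {c : List ℕ} {p q : Val k V}
    {κ : List ℕ → Set V} (hqp : q ≤ p) (h : WarmStart A G R js c p κ) :
    WarmStart A G R js c q κ := by
  induction js generalizing c p q with
  | nil => trivial
  | cons j js ih =>
    refine ⟨((nested A G R (j :: js)).monotone hqp).trans h.1,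
      (outerHom_mono j _ hqp _).trans h.2.1, fun i => ih ?_ (h.2.2 i)⟩
    exact Val.set_mono hqp j le_rfl (iterate_mono_of_le (innerHom_mono j _ hqp le_rfl) i)

theorem WarmStart.congr {js : List (Fin (k + 1))} {c : List ℕ} {p : Val k V}
    {κ κ' : List ℕ → Set V} (hκ : ∀ d, c <+: d → κ' d = κ d) (h : WarmStart A G R js c p κ) :
    WarmStart A G R js c p κ' := by
  induction js generalizing c p with
  | nil => trivial
  | cons j js ih =>
    have hc := hκ c (List.prefix_refl c)
    refine ⟨hc ▸ h.1, by rw [hc]; exact h.2.1, fun i => ?_⟩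
    rw [hc]
    exact ih (fun d hd => hκ d ((List.prefix_append c [i]).trans hd)) (h.2.2 i)

theorem warmStart_univ (js : List (Fin (k + 1))) (c : List ℕ) (p : Val k V) :
    WarmStart A G R js c p fun _ => Set.univ := by
  induction js generalizing c p with
  | nil => trivial
  | cons j js ih => exact ⟨Set.subset_univ _, Set.subset_univ _, fun i => ih _ _⟩

/-- Amortized cost of one evaluation with `D` nested pairs of fixpoints on `n` vertices. -/
def evalCost (k n : ℕ) : ℕ → ℕ
  | 0 => 11 * (k + 1)
  | D + 1 => (n + 1) * (evalCost k n D + 1) + 1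

/-- Bound for the cost of the further shrinking of the cached values. -/
def potential (k n : ℕ) : ℕ → List ℕ → (List ℕ → Set V) → ℕ
  | 0, _, _ => 0
  | D + 1, c, κ => evalCost k n (D + 1) * (κ c).ncard +
      ∑ i ∈ Finset.range (n + 1), potential k n D (c ++ [i]) κ

theorem potential_congr {n D : ℕ} {c : List ℕ} {κ κ' : List ℕ → Set V}
    (h : ∀ d, c <+: d → κ' d = κ d) : potential k n D c κ' = potential k n D c κ := by
  induction D generalizing c with
  | zero => rfl
  | succ D ih =>
    rw [potential, potential, h c (List.prefix_refl c)]
    congr 1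
    exact Finset.sum_congr rfl fun i _ => ih fun d hd => h d ((List.prefix_append c [i]).trans hd)

theorem evalBody_spec (p : Val k V) (js : List (Fin (k + 1))) (s : EvalState V) :
    evalBody A G R p js s =
      ({v | ∃ j ∈ js, v ∈ (ext R j)ᶜ ∩ core A G j p},
        { s with steps := s.steps + 11 * js.length }) := by
  induction js generalizing s with
  | nil =>
    change ((∅ : Set V), s) = _
    simp
  | cons j js ih =>
    have h : evalBody A G R p (j :: js) s =
        ((((ext R j)ᶜ ∩ core A G j p) ∪
          (evalBody A G R p js { s with steps := s.steps + 10 }).1),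
        { (evalBody A G R p js { s with steps := s.steps + 10 }).2 with
          steps := (evalBody A G R p js { s with steps := s.steps + 10 }).2.steps + 1 }) := rfl
    rw [h, ih]
    refine congrArg₂ Prod.mk ?_ ?_
    · ext v
      simp
    · simp only [List.length_cons, EvalState.mk.injEq, true_and]
      omega

theorem prefix_append_singleton_inj {c d : List ℕ} {i i' : ℕ} (h : c ++ [i] <+: d)
    (h' : c ++ [i'] <+: d) : i = i' := by
  obtain ⟨t, rfl⟩ := h
  obtain ⟨t', ht⟩ := h'
  simp only [List.append_assoc, List.append_cancel_left_eq, List.cons_append,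
    List.nil_append, List.cons.injEq] at ht
  exact ht.1.symm

theorem evalNested_cons_run [Fintype V] (j : Fin (k + 1)) (js : List (Fin (k + 1)))
    (c : List ℕ) (p : Val k V) (s : EvalState V) :
    evalNested A G R (j :: js) c p s =
      (let r := iterate (fun _ S => iterate
          (fun i T => evalNested A G R js (c ++ [i]) (p.set j S T)) (Fintype.card V + 1) 0 ∅)
        (Fintype.card V + 1) 0 (s.cache c) s
      (r.1, { r.2 with cache := Function.update r.2.cache c r.1 })) := rfl

/-- Correctness, preservation of the warm start, locality of cache writes and amortized cost need
one another in the induction, so they are proved together. -/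
theorem evalNested_spec [Fintype V] (js : List (Fin (k + 1))) (c : List ℕ) (p : Val k V)
    (s : EvalState V) (hs : WarmStart A G R js c p s.cache) :
    (evalNested A G R js c p s).1 = nested A G R js p ∧
    WarmStart A G R js c p (evalNested A G R js c p s).2.cache ∧
    (∀ d, ¬ c <+: d → (evalNested A G R js c p s).2.cache d = s.cache d) ∧
    (evalNested A G R js c p s).2.steps +
        potential k (Fintype.card V) js.length c (evalNested A G R js c p s).2.cache ≤
      s.steps + potential k (Fintype.card V) js.length c s.cache +
        evalCost k (Fintype.card V) js.length := by
  induction js generalizing c p s with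
  | nil =>
    rw [evalNested, evalBody_spec]
    refine ⟨?_, trivial, fun _ _ => rfl, ?_⟩
    · ext v
      change _ ↔ v ∈ ⋃ j, (ext R j)ᶜ ∩ core A G j p
      simp
    · simp [potential, evalCost]
  | cons j js ih =>
    set n := Fintype.card V with hn
    set f : Set V → Eval V (Set V) := fun S => iterate
          (fun i T => evalNested A G R js (c ++ [i]) (p.set j S T)) (n + 1) 0 ∅ with hf
    set F := outerHom j (nested A G R js) p with hF
    let X : Set V → ℕ → Set V := fun S i => (innerHom j (nested A G R js) p S)^[i] ∅
    let I : Set V → (List ℕ → Set V) → Prop := fun S κ =>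
      (∀ i, WarmStart A G R js (c ++ [i]) (p.set j S (X S i)) κ) ∧
      ∀ d, (∀ i, ¬ c ++ [i] <+: d) → κ d = s.cache d
    let Ψ : (List ℕ → Set V) → ℕ := fun κ =>
      ∑ i ∈ Finset.range (n + 1), potential k n js.length (c ++ [i]) κ
    have hI : ∀ S S' κ, S' ≤ S → I S κ → I S' κ := fun S S' κ h hκ =>
      ⟨fun i => (hκ.1 i).anti (Val.set_mono le_rfl j h
        (iterate_mono_of_le (innerHom_mono j _ le_rfl h) i)), hκ.2⟩
    have hstep : ∀ S, ∀ t : EvalState V, I S t.cache →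
        (f S t).1 = F S ∧ I S (f S t).2.cache ∧
        (f S t).2.steps + Ψ (f S t).2.cache ≤
          t.steps + Ψ t.cache + (n + 1) * (evalCost k n js.length + 1) := by
      intro S t ht
      refine iterate_mu (I := I S) Ψ (fun i hi u hu => ?_) t ht
      obtain ⟨h1, h2, h3, h4⟩ := ih (c ++ [i]) (p.set j S (X S i)) u (hu.1 i)
      -- Sibling `μ`-counters use disjoint parts of the cache, so this call changes neither their
      -- warm starts nor their potentials.
      have hframe : ∀ i', i' ≠ i → ∀ d, c ++ [i'] <+: d →
          (evalNested A G R js (c ++ [i]) (p.set j S (X S i)) u).2.cache d = u.cache d :=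
        fun i' hi' d hd => h3 d fun hd' => hi' (prefix_append_singleton_inj hd hd')
      refine ⟨h1, ⟨fun i' => ?_, fun d hd => ?_⟩, ?_⟩
      · by_cases hi' : i' = i
        · exact hi' ▸ h2
        · exact (hu.1 i').congr (hframe i' hi')
      · rw [h3 d (hd i), hu.2 d hd]
      · have hmem : i ∈ Finset.range (n + 1) := Finset.mem_range.2 hi
        simp only [Ψ]
        rw [← Finset.add_sum_erase _ _ hmem, ← Finset.add_sum_erase _ _ hmem]
        have : ∀ i' ∈ (Finset.range (n + 1)).erase i,
            potential k n js.length (c ++ [i'])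
              (evalNested A G R js (c ++ [i]) (p.set j S (X S i)) u).2.cache =
            potential k n js.length (c ++ [i']) u.cache := fun i' hi' =>
          potential_congr (hframe i' (Finset.ne_of_mem_erase hi'))
        rw [Finset.sum_congr rfl this]
        simp only [X] at h4 ⊢
        omega
    have hcard : (s.cache c).ncard < n + 1 := by
      have := Set.ncard_le_card (s.cache c)
      rw [Nat.card_eq_fintype_card] at this
      omega
    obtain ⟨h1, h2, h3⟩ := iterate_nu Ψ hI hstep (n + 1) 0 (s.cache c) s
      ⟨hs.2.2, fun _ _ => rfl⟩ hs.1 hs.2.1 hcard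
    rw [evalNested_cons_run]
    simp only
    set r := iterate (fun _ => f) (n + 1) 0 (s.cache c) s with hr
    -- Writing the final value at `c` must not disturb the cache entries of the inner variables.
    have hcc : ∀ i d, c ++ [i] <+: d → d ≠ c := by
      rintro i d hd rfl
      simpa using hd.length_le
    have hup : ∀ i d, c ++ [i] <+: d → Function.update r.2.cache c r.1 d = r.2.cache d :=
      fun i d hd => Function.update_of_ne (hcc i d hd) _ _
    refine ⟨h1, ⟨?_, ?_, fun i => ?_⟩, fun d hd => ?_, ?_⟩
    · rw [Function.update_self, h1]
      exact le_rfl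
    · rw [Function.update_self, h1, F.map_gfp]
    · rw [Function.update_self, h1]
      have := (h2.1 i).congr (κ' := Function.update r.2.cache c r.1) (hup i)
      rwa [h1] at this
    · rw [Function.update_of_ne (by rintro rfl; exact hd (List.prefix_refl _))]
      exact h2.2 d fun i hi => hd ((List.prefix_append c [i]).trans hi)
    · simp only [List.length_cons, potential, Function.update_self]
      rw [Finset.sum_congr rfl fun i _ => potential_congr (hup i)]
      rw [h1]
      simp only [Ψ] at h3
      simp only [evalCost] at h3 ⊢
      nlinarith

theorem algorithm_fst [Fintype V] : (algorithm A G R).1 = chainFixpoint A G R :=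
  (evalNested_spec (chainOrder k) [] ⊥ _ (warmStart_univ _ _ _)).1

/-! ### Step bound of the accelerated algorithm -/

theorem evalCost_le {n : ℕ} (hn : 1 ≤ n) (D : ℕ) :
    evalCost k n D + 1 ≤ 4 ^ D * (11 * (k + 1) + 1) * n ^ D := by
  induction D with
  | zero => simp [evalCost]
  | succ D ih =>
    have h1 : 1 ≤ evalCost k n D + 1 := by omega
    calc evalCost k n (D + 1) + 1 = (n + 1) * (evalCost k n D + 1) + 2 := by rw [evalCost]
      -- Half of the factor covers `n + 1 ≤ 2 * n`, the other half the summand `2`.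
      _ ≤ 4 * n * (evalCost k n D + 1) := by nlinarith
      _ ≤ 4 * n * (4 ^ D * (11 * (k + 1) + 1) * n ^ D) := Nat.mul_le_mul_left _ ih
      _ = _ := by ring

/-- Each of the `D` levels contributes order `n ^ (D + 1)`: further in there are more counter
tuples, but a round is cheaper by the same factor. -/
theorem potential_le [Fintype V] [Nonempty V] (D : ℕ) (c : List ℕ) (κ : List ℕ → Set V) :
    potential k (Fintype.card V) D c κ ≤
      D * 4 ^ D * (11 * (k + 1) + 1) * Fintype.card V ^ (D + 1) := by
  have hn : 1 ≤ Fintype.card V := Fintype.card_pos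
  induction D generalizing c with
  | zero => simp [potential]
  | succ D ih =>
    rw [potential]
    have h2 := evalCost_le (k := k) hn (D + 1)
    set n := Fintype.card V
    set K := 11 * (k + 1) + 1
    have h1 : (κ c).ncard ≤ n := by
      have := Set.ncard_le_card (κ c)
      rwa [Nat.card_eq_fintype_card] at this
    have h3 : ∑ i ∈ Finset.range (n + 1), potential k n D (c ++ [i]) κ ≤
        (n + 1) * (D * 4 ^ D * K * n ^ (D + 1)) := by
      refine (Finset.sum_le_card_nsmul _ _ _ fun i _ => ih (c ++ [i])).trans ?_
      simp
    calc _ ≤ (4 ^ (D + 1) * K * n ^ (D + 1)) * n + 4 * n * (D * 4 ^ D * K * n ^ (D + 1)) :=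
          add_le_add (Nat.mul_le_mul (by omega) h1)
            (h3.trans (Nat.mul_le_mul_right _ (by omega)))
      _ = _ := by ring

theorem algorithm_snd_le [Fintype V] [Nonempty V] :
    (algorithm A G R).2 ≤
      (k + 2) * 4 ^ (k + 1) * (11 * (k + 1) + 1) * Fintype.card V ^ (k + 2) := by
  have hn : 1 ≤ Fintype.card V := Fintype.card_pos
  have h := (evalNested_spec (A := A) (G := G) (R := R) (chainOrder k) [] ⊥
    { cache := fun _ => Set.univ, steps := 0 } (warmStart_univ _ _ _)).2.2.2
  have hl : (chainOrder k).length = k + 1 := by simp [chainOrder]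
  rw [hl] at h
  have h1 := potential_le (k := k) (k + 1) [] fun _ => (Set.univ : Set V)
  have h2 := evalCost_le (k := k) hn (k + 1)
  set n := Fintype.card V
  set K := 11 * (k + 1) + 1
  have h3 : 4 ^ (k + 1) * K * n ^ (k + 1) ≤ 4 ^ (k + 1) * K * n ^ (k + 2) :=
    Nat.mul_le_mul_left _ (Nat.pow_le_pow_right hn (by omega))
  have h4 : (algorithm A G R).2 = (evalNested A G R (chainOrder k) [] ⊥
    { cache := fun _ => Set.univ, steps := 0 }).2.steps := rfl
  rw [h4]
  have h5 : (k + 2) * 4 ^ (k + 1) * K * n ^ (k + 2) =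
      (k + 1) * 4 ^ (k + 1) * K * n ^ (k + 1 + 1) + 4 ^ (k + 1) * K * n ^ (k + 2) := by ring
  rw [h5]
  simp only at h
  have h6 : n ^ (k + 1 + 1) = n ^ (k + 2) := rfl
  rw [h6] at h1 ⊢
  omega

end Algorithm

/-! ### The Rabin fixpoint for a chain condition -/

section Chain

variable {A : LiveGame V} {G R : Fin k → Set V}

theorem nuMu_mono_left {j : Fin (k + 1)} {f g : Val k V →o Set V} (h : f ≤ g) :
    nuMu j f ≤ nuMu j g :=
  fun _ => OrderHom.gfp.monotone fun _ => OrderHom.lfp.monotone fun _ => h _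

theorem chainOrder_pairwise (h : Antitone G) :
    (chainOrder k).Pairwise fun a b => ext G a ⊆ ext G b := by
  refine List.pairwise_cons.2 ⟨fun b _ => by simp [ext], ?_⟩
  rw [List.pairwise_map, List.pairwise_reverse]
  refine (List.pairwise_le_finRange k).imp fun {a b} hab => ?_
  simpa [ext] using h hab

theorem mem_chainOrder (j : Fin (k + 1)) : j ∈ chainOrder k := by
  induction j using Fin.cases <;> simp [chainOrder]

theorem chainOrder_nodup : (chainOrder k).Nodup := by
  refine List.nodup_cons.2 ⟨by simp, ?_⟩
  exact (List.nodup_reverse.2 (List.nodup_finRange k)).map (Fin.succ_injective k)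

theorem length_chainOrder : (chainOrder k).length = k + 1 := by simp [chainOrder]

theorem core_congr {j : Fin (k + 1)} {p q : Val k V} (h1 : p.1 j = q.1 j) (h2 : p.2 j = q.2 j) :
    core A G j p = core A G j q := by
  rw [core, core, h1, h2]

theorem core_subset {i j : Fin (k + 1)} {p q : Val k V} (hG : ext G i ⊆ ext G j)
    (h1 : p.1 i ≤ q.1 j) (h2 : p.2 i ≤ q.2 j) : core A G i p ⊆ core A G j q :=
  Set.union_subset_union (Set.inter_subset_inter hG (A.cpre_mono h1)) (A.apre_mono h1 h2)

theorem Val.set_fst_self (p : Val k V) (j : Fin (k + 1)) (S T : Set V) : (p.set j S T).1 j = S :=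
  Function.update_self ..

theorem Val.set_snd_self (p : Val k V) (j : Fin (k + 1)) (S T : Set V) : (p.set j S T).2 j = T :=
  Function.update_self ..

theorem Val.set_fst_of_ne (p : Val k V) {i j : Fin (k + 1)} (h : i ≠ j) (S T : Set V) :
    (p.set j S T).1 i = p.1 i :=
  Function.update_of_ne h ..

theorem Val.set_snd_of_ne (p : Val k V) {i j : Fin (k + 1)} (h : i ≠ j) (S T : Set V) :
    (p.set j S T).2 i = p.2 i :=
  Function.update_of_ne h ..

theorem mem_chainBody {p : Val k V} {v : V} :
    v ∈ chainBody A G R p ↔ ∃ j, v ∉ ext R j ∧ v ∈ core A G j p := by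
  change v ∈ ⋃ j, (ext R j)ᶜ ∩ core A G j p ↔ _
  simp

theorem mem_rabinBody {δ : List (Fin (k + 1))} {p : Val k V} {v : V} :
    v ∈ rabinBody A G R δ p ↔ ∃ (J : ℕ) (h : J < δ.length),
      (∀ i, ∀ hi : i ≤ J, v ∉ ext R (δ[i]'(hi.trans_lt h))) ∧ v ∈ core A G δ[J] p := by
  change v ∈ ⋃ j : Fin δ.length,
    (⋂ i : Fin δ.length, ⋂ _ : i ≤ j, (ext R (δ.get i))ᶜ) ∩ core A G (δ.get j) p ↔ _
  simp only [Set.mem_iUnion, Set.mem_inter_iff, Set.mem_iInter, Set.mem_compl_iff, Fin.exists_iff,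
    List.get_eq_getElem, Fin.forall_iff, Fin.mk_le_mk]
  exact exists_congr fun J => exists_congr fun h =>
    and_congr_left fun _ => ⟨fun H i hi => H i (hi.trans_lt h) hi, fun H i _ hi => H i hi⟩

theorem mem_rabinBody_append {δ : List (Fin (k + 1))} {q : Fin (k + 1)} {p : Val k V} {v : V}
    (h : v ∈ rabinBody A G R (δ ++ [q]) p) : v ∈ rabinBody A G R δ p ∨
      ((∀ i ∈ δ, v ∉ ext R i) ∧ v ∉ ext R q ∧ v ∈ core A G q p) := by
  obtain ⟨J, hJ, hR, hc⟩ := mem_rabinBody.1 h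
  by_cases hJ' : J < δ.length
  · refine Or.inl (mem_rabinBody.2 ⟨J, hJ', fun i hi => ?_, ?_⟩)
    · simpa [List.getElem_append_left (hi.trans_lt hJ')] using hR i hi
    · simpa [List.getElem_append_left hJ'] using hc
  · obtain rfl : J = δ.length := by simp at hJ; omega
    refine Or.inr ⟨fun i hi => ?_, ?_, ?_⟩
    · obtain ⟨I, hI, rfl⟩ := List.getElem_of_mem hi
      simpa [List.getElem_append_left hI] using hR I hI.le
    · simpa using hR _ le_rfl
    · simpa using hc

theorem rabinBody_set {δ : List (Fin (k + 1))} {q : Fin (k + 1)} (hq : q ∉ δ) (p : Val k V)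
    (S T : Set V) : rabinBody A G R δ (p.set q S T) = rabinBody A G R δ p := by
  ext v
  rw [mem_rabinBody, mem_rabinBody]
  refine exists_congr fun J => exists_congr fun h => and_congr_right fun _ => ?_
  have : δ[J] ≠ q := fun e => hq (e ▸ List.getElem_mem h)
  rw [core_congr (p.set_fst_of_ne this S T) (p.set_snd_of_ne this S T)]

/-- The sets `ext R` grow along the chain order, so the intersection over earlier indices is implied
by its last member. -/
theorem chainBody_le_rabinBody (hR : Antitone R) :
    chainBody A G R ≤ rabinBody A G R (chainOrder k) := by
  intro p v hv
  obtain ⟨j, hj, hc⟩ := mem_chainBody.1 hv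
  obtain ⟨J, hJ, rfl⟩ := List.getElem_of_mem (mem_chainOrder j)
  refine mem_rabinBody.2 ⟨J, hJ, fun i hi h => hj ?_, hc⟩
  rcases hi.eq_or_lt with rfl | hlt
  · exact h
  · exact List.pairwise_iff_getElem.1 (chainOrder_pairwise hR) i J _ hJ hlt h

theorem nested_le_rabinNested (js δ : List (Fin (k + 1))) (hδ : (δ ++ js).Nodup)
    (h : chainBody A G R ≤ rabinBody A G R (δ ++ js)) :
    nested A G R js ≤ rabinNested A G R js.length δ := by
  induction js generalizing δ with
  | nil =>
    rw [List.append_nil] at h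
    exact h
  | cons j js ih =>
    have hj : j ∉ δ := fun hj => (List.nodup_append.1 hδ).2.2 j hj j (by simp) rfl
    have := nuMu_mono_left (j := j) (ih (δ ++ [j]) (by simpa using hδ) (by simpa using h))
    exact this.trans (le_iSup₂ (f := fun q (_ : q ∉ δ) =>
      nuMu q (rabinNested A G R js.length (δ ++ [q]))) j hj)

theorem chainFixpoint_le_rabinFixpoint (hR : Antitone R) :
    chainFixpoint A G R ≤ rabinFixpoint A G R := by
  have h := nested_le_rabinNested (A := A) (G := G) ((List.finRange k).reverse.map Fin.succ) [0]
    chainOrder_nodup (chainBody_le_rabinBody hR)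
  simp only [List.length_map, List.length_reverse, List.length_finRange] at h
  exact nuMu_mono_left h ⊥

/-! ### Absorbing arbitrary permutations into the chain order -/

theorem le_set_of_eq_empty {e : Val k V} {j : Fin (k + 1)} (h1 : e.1 j = ∅) (h2 : e.2 j = ∅)
    (S T : Set V) : e ≤ e.set j S T := by
  constructor
  · exact le_update_iff.2 ⟨h1 ▸ Set.empty_subset _, fun _ _ => le_rfl⟩
  · exact le_update_iff.2 ⟨h2 ▸ Set.empty_subset _, fun _ _ => le_rfl⟩

/-- Indices that a permutation skips are inserted here: replacing an empty value by a fixpoint value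
can only enlarge the result. -/
theorem nested_le_nested_append (js₁ js₂ : List (Fin (k + 1))) {e : Val k V}
    (he : ∀ j ∈ js₁, e.1 j = ∅ ∧ e.2 j = ∅) :
    nested A G R js₂ e ≤ nested A G R (js₁ ++ js₂) e := by
  induction js₁ with
  | nil => exact le_rfl
  | cons j js₁ ih =>
    refine (ih fun i hi => he i (List.mem_cons_of_mem j hi)).trans ?_
    have hj := he j List.mem_cons_self
    change _ ≤ nuMu j (nested A G R (js₁ ++ js₂)) e
    rw [← map_nuMu]
    exact (nested A G R (js₁ ++ js₂)).monotone (le_set_of_eq_empty hj.1 hj.2 _ _)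

/-- Comparison of two fixpoints whose bodies need to be compared only below the value `Y` of the
first one, and where `X` is closed under the second body. -/
theorem nuMu_le_nuMu {q : Fin (k + 1)} {f g : Val k V →o Set V} {p e : Val k V}
    (h : ∀ X ≤ nuMu q f p, f (p.set q (nuMu q f p) X) ≤ nuMu q f p →
      g (e.set q (nuMu q f p) X) ⊓ nuMu q f p ≤ X →
      f (p.set q (nuMu q f p) X) ≤ g (e.set q (nuMu q f p) X)) :
    nuMu q f p ≤ nuMu q g e := by
  set Y := nuMu q f p with hY
  -- The second inner iteration is cut off at `Y`. Its least fixpoint is closed under the first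
  -- body, hence is all of `Y`, and this makes `Y` a post-fixpoint of the second outer operator.
  let H : Set V →o Set V := innerHom q g e Y ⊓ OrderHom.const _ Y
  have hL : innerHom q g e Y H.lfp ⊓ Y = H.lfp := H.map_lfp
  have hLY : H.lfp ≤ Y := by rw [← hL]; exact inf_le_right
  have hfY : f (p.set q Y H.lfp) ≤ Y := by
    conv_rhs => rw [hY, ← map_nuMu, ← hY]
    exact f.monotone (Val.set_mono le_rfl q le_rfl hLY)
  have hYL : Y ≤ H.lfp := by
    conv_lhs => rw [hY, nuMu_eq, ← OrderHom.map_gfp, ← nuMu_eq, ← hY]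
    refine (innerHom q f p Y).lfp_le ?_
    conv_rhs => rw [← hL]
    exact le_inf (h _ hLY hfY hL.le) hfY
  rw [nuMu_eq q g]
  refine (outerHom q g e).le_gfp (hYL.trans ?_)
  exact OrderHom.lfp.monotone (show H ≤ innerHom q g e Y from inf_le_left)

/-- A fixpoint is below `H` if its body maps the sets below `H` to sets below `H`. -/
theorem nuMu_le {q : Fin (k + 1)} {f : Val k V →o Set V} {p : Val k V} {H : Set V}
    (h : ∀ X ≤ nuMu q f p, X ≤ H → f (p.set q (nuMu q f p) X) ≤ nuMu q f p →
      f (p.set q (nuMu q f p) X) ≤ H) :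
    nuMu q f p ≤ H := by
  set Y := nuMu q f p with hY
  have hfY : f (p.set q Y (Y ⊓ H)) ≤ Y := by
    conv_rhs => rw [hY, ← map_nuMu, ← hY]
    exact f.monotone (Val.set_mono le_rfl q le_rfl inf_le_left)
  have hYL : Y ≤ Y ⊓ H := by
    conv_lhs => rw [hY, nuMu_eq, ← OrderHom.map_gfp, ← nuMu_eq, ← hY]
    exact (innerHom q f p Y).lfp_le (le_inf hfY (h _ inf_le_left inf_le_right hfY))
  exact hYL.trans inf_le_right

/-- Along a sequence `δ` of indices, only those matter that are smaller than all previous ones.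
Here `r` is the last such index, `js` lists the smaller ones in decreasing order, and `e` are values
of the variables of the chain fixpoint. -/
theorem rabinNested_le_nested (m : ℕ) (δ js : List (Fin (k + 1))) (r : Fin (k + 1))
    (p e : Val k V) (hr : r ∈ δ) (hrem : ∀ q ∉ δ, q ∈ js ∨ ext G q ⊆ ext G r)
    (hjs : (r :: js).Pairwise fun a b => ext G a ⊆ ext G b) (hnd : js.Nodup)
    (hδ : ∀ q ∈ js, q ∉ δ)
    (he : ∀ q ∈ js, e.1 q = ∅ ∧ e.2 q = ∅) (hbody : rabinBody A G R δ p ≤ chainBody A G R e)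
    (hY : rabinNested A G R m δ p ≤ e.1 r) (hX : nested A G R js e ⊓ e.1 r ≤ e.2 r) :
    rabinNested A G R m δ p ≤ nested A G R js e := by
  induction m generalizing δ js r p e with
  | zero =>
    have := nested_le_nested_append (A := A) (G := G) (R := R) js [] he
    rw [List.append_nil] at this
    exact le_trans hbody this
  | succ m ih =>
    have hsup : rabinNested A G R (m + 1) δ p =
        ⨆ q : Fin (k + 1), ⨆ _ : q ∉ δ, nuMu q (rabinNested A G R m (δ ++ [q])) p := by
      rw [rabinNested]
      simp only [OrderHom.iSup_apply]
    rw [hsup] at hY ⊢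
    refine iSup₂_le fun q hq => ?_
    have hqY : nuMu q (rabinNested A G R m (δ ++ [q])) p ≤ e.1 r := (le_iSup₂ (f := fun q
      (_ : q ∉ δ) => nuMu q (rabinNested A G R m (δ ++ [q])) p) q hq).trans hY
    -- If `q` is a new record, both sides bind it and `q` replaces `r`; otherwise the term of `r`
    -- absorbs that of `q`.
    by_cases hqjs : q ∈ js
    · obtain ⟨js₁, js₂, rfl⟩ := List.append_of_mem hqjs
      refine le_trans ?_ (nested_le_nested_append js₁ (q :: js₂) fun j hj => he j (by simp [hj]))
      change _ ≤ nuMu q (nested A G R js₂) e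
      refine nuMu_le_nuMu fun X hXY hfY hgX => ?_
      have hrq : ext G r ⊆ ext G q := (List.pairwise_cons.1 hjs).1 q hqjs
      have hp := List.pairwise_append.1 (List.pairwise_cons.1 hjs).2
      have hn := List.nodup_append.1 hnd
      have hq2 : q ∉ js₂ := (List.nodup_cons.1 hn.2.1).1
      refine ih (δ ++ [q]) js₂ q _ _ (by simp) (fun q' hq' => ?_) hp.2.1
        (List.nodup_cons.1 hn.2.1).2 (fun q' hq' hm => ?_) (fun q' hq' => ?_) (fun v hv => ?_)
        (by rwa [Val.set_fst_self]) (by rwa [Val.set_fst_self, Val.set_snd_self])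
      · simp only [List.mem_append, List.mem_singleton, not_or] at hq'
        rcases hrem q' hq'.1 with h | h
        · simp only [List.mem_append, List.mem_cons, hq'.2, false_or] at h
          exact h.symm.imp_right fun h1 => hp.2.2 q' h1 q (by simp)
        · exact Or.inr (h.trans hrq)
      · simp only [List.mem_append, List.mem_singleton] at hm
        rcases hm with hm | rfl
        · exact hδ q' (by simp [hq']) hm
        · exact hq2 hq'
      · have hne : q' ≠ q := fun h => hq2 (h ▸ hq')
        rw [Val.set_fst_of_ne _ hne, Val.set_snd_of_ne _ hne]
        exact he q' (by simp [hq'])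
      · rcases mem_rabinBody_append hv with h | ⟨-, hR, hc⟩
        · rw [rabinBody_set hq] at h
          exact (chainBody A G R).monotone
            (le_set_of_eq_empty (he q hqjs).1 (he q hqjs).2 _ _) (hbody h)
        · refine mem_chainBody.2 ⟨q, hR, ?_⟩
          rwa [core_congr (q := p.set q _ X) (by rw [Val.set_fst_self, Val.set_fst_self])
            (by rw [Val.set_snd_self, Val.set_snd_self])]
    · have hqr : ext G q ⊆ ext G r := (hrem q hq).resolve_left hqjs
      refine nuMu_le fun X hXY hXH hfY => ?_
      refine ih (δ ++ [q]) js r _ e (by simp [hr]) (fun q' hq' => ?_) hjs hnd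
        (fun q' hq' hm => ?_) he (fun v hv => ?_) (hfY.trans hqY) hX
      · exact hrem q' fun h => hq' (by simp [h])
      · simp only [List.mem_append, List.mem_singleton] at hm
        rcases hm with hm | rfl
        · exact hδ q' hq' hm
        · exact hqjs hq'
      · rcases mem_rabinBody_append hv with h | ⟨hR, -, hc⟩
        · rw [rabinBody_set hq] at h
          exact hbody h
        · refine mem_chainBody.2 ⟨r, hR r hr, core_subset hqr ?_ ?_ hc⟩
          · rw [Val.set_fst_self]
            exact hqY
          · rw [Val.set_snd_self]
            -- `X_q` is below both the target fixpoint and `Y_r`, so closedness of `X_r` puts it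
            -- below `X_r`.
            exact (le_inf hXH (hXY.trans hqY)).trans hX

theorem rabinFixpoint_eq_chainFixpoint (hG : Antitone G) (hR : Antitone R) :
    rabinFixpoint A G R = chainFixpoint A G R := by
  refine le_antisymm ?_ (chainFixpoint_le_rabinFixpoint hR)
  change nuMu 0 _ ⊥ ≤ nuMu 0 (nested A G R ((List.finRange k).reverse.map Fin.succ)) ⊥
  have hnd := List.nodup_cons.1 (chainOrder_nodup (k := k))
  refine nuMu_le_nuMu fun X hXY hfY hgX => ?_
  refine rabinNested_le_nested k [0] _ 0 _ _ (by simp) (fun q hq => Or.inl ?_)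
    (chainOrder_pairwise hG) hnd.2 (fun q hq h => ?_) (fun q hq => ?_) (fun v hv => ?_)
    (by rwa [Val.set_fst_self]) (by rwa [Val.set_fst_self, Val.set_snd_self])
  · exact (List.mem_cons.1 (mem_chainOrder q)).resolve_left (by simpa using hq)
  · rw [List.mem_singleton.1 h] at hq
    exact hnd.1 hq
  · have hne : q ≠ 0 := fun h => hnd.1 (h ▸ hq)
    rw [Val.set_fst_of_ne _ hne, Val.set_snd_of_ne _ hne]
    exact ⟨rfl, rfl⟩
  · obtain ⟨J, hJ, hR', hc⟩ := mem_rabinBody.1 hv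
    exact mem_chainBody.2 ⟨_, hR' J le_rfl, hc⟩

end Chain

/-! ### Lexicographic order of lists -/

theorem nil_le_list (a : List ℕ) : [] ≤ a :=
  not_lt.1 (List.not_lt_nil a)

theorem cons_le_cons_iff_lex {x y : ℕ} {a b : List ℕ} :
    x :: a ≤ y :: b ↔ x < y ∨ x = y ∧ a ≤ b := by
  rw [← not_lt, ← not_lt (a := b)]
  exact List.cons_le_cons_iff

theorem take_le_take {a b : List ℕ} (h : a ≤ b) (m : ℕ) : a.take m ≤ b.take m := by
  induction m generalizing a b with
  | zero => simp
  | succ m ih =>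
    match a, b with
    | [], _ => exact nil_le_list _
    | x :: a, [] => exact absurd (List.nil_lt_cons x a) (not_lt.2 h)
    | x :: a, y :: b =>
      rw [cons_le_cons_iff_lex] at h
      rw [List.take_succ_cons, List.take_succ_cons, cons_le_cons_iff_lex]
      exact h.imp_right fun h => ⟨h.1, ih h.2⟩

theorem take_le_take_of_le {a b : List ℕ} {l m : ℕ} (hlm : l ≤ m) (h : a.take m ≤ b.take m) :
    a.take l ≤ b.take l := by
  have := take_le_take h l
  rwa [List.take_take, List.take_take, min_eq_left hlm] at this

theorem exists_least_list {P : List ℕ → Prop} {n : ℕ} (hP : ∀ c, P c → c.length = n)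
    (h : ∃ c, P c) : ∃ c, P c ∧ ∀ c', P c' → c ≤ c' := by
  classical
  induction n generalizing P with
  | zero =>
    obtain ⟨c, hc⟩ := h
    obtain rfl := List.length_eq_zero_iff.1 (hP c hc)
    exact ⟨[], hc, fun c' _ => nil_le_list c'⟩
  | succ n ih =>
    have hex : ∃ i, ∃ c, P (i :: c) := by
      obtain ⟨c, hc⟩ := h
      match c, hP c hc, hc with
      | i :: c, _, hc => exact ⟨i, c, hc⟩
    obtain ⟨c, hc, hmin⟩ := ih (P := fun c => P (Nat.find hex :: c))
      (fun c hc => by simpa using hP _ hc) (Nat.find_spec hex)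
    refine ⟨Nat.find hex :: c, hc, fun c' hc' => ?_⟩
    match c', hP c' hc', hc' with
    | i :: c', _, hc' =>
      rw [cons_le_cons_iff_lex]
      rcases (Nat.find_min' hex ⟨c', hc'⟩).lt_or_eq with h | h
      · exact Or.inl h
      · exact Or.inr ⟨h, hmin c' (by rwa [h])⟩

/-! ### Positions in the chain order -/

/-- The index at position `J` of the chain order. -/
def chainIndex (J : Fin (k + 1)) : Fin (k + 1) :=
  (chainOrder k)[(J : ℕ)]'(length_chainOrder.symm ▸ J.2)

theorem chainIndex_surjective : Function.Surjective (chainIndex (k := k)) := by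
  intro j
  obtain ⟨J, hJ, h⟩ := List.getElem_of_mem (mem_chainOrder j)
  exact ⟨⟨J, length_chainOrder ▸ hJ⟩, h⟩

theorem ext_chainIndex_mono {R : Fin k → Set V} (hR : Antitone R) {J J' : Fin (k + 1)}
    (h : J ≤ J') : ext R (chainIndex J) ⊆ ext R (chainIndex J') := by
  rcases h.eq_or_lt with rfl | h
  · exact subset_rfl
  · exact List.pairwise_iff_getElem.1 (chainOrder_pairwise hR) J J' _ _ h

/-! ### Vertices visited infinitely often -/

theorem eventually_frequently_visited [Finite V] (π : ℕ → V) :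
    ∀ᶠ i in atTop, ∃ᶠ l in atTop, π l = π i := by
  have : ∀ᶠ i in atTop, ∀ v, (¬ ∃ᶠ l in atTop, π l = v) → π i ≠ v := by
    refine eventually_all.2 fun v => ?_
    by_cases hv : ∃ᶠ l in atTop, π l = v
    · exact Eventually.of_forall fun _ h => absurd hv h
    · exact (not_frequently.1 hv).mono fun i hi _ => hi
  filter_upwards [this] with i hi
  by_contra h
  exact hi _ h rfl

/-! ### Ranks -/

section Rank

variable {A : LiveGame V} {G R : Fin k → Set V}

theorem exists_iterate_empty_eq_lfp [Finite V] (g : Set V →o Set V) :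
    ∃ i, g^[i] ∅ = g.lfp := by
  obtain ⟨n, hn⟩ := WellFoundedGT.monotone_chain_condition ⟨fun i => g^[i] ∅, iterate_empty_mono g⟩
  refine ⟨n, iterate_eq_lfp ?_⟩
  rw [← Function.iterate_succ_apply' g]
  exact (hn (n + 1) n.le_succ).symm

theorem exists_mem_stage [Finite V] {js : List (Fin (k + 1))} {p : Val k V} {v : V}
    (h : v ∈ nested A G R js p) : ∃ c, c.length = js.length ∧ v ∈ stage A G R js c p := by
  induction js generalizing p with
  | nil => exact ⟨[], rfl, h⟩
  | cons j js ih =>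
    set Y := nested A G R (j :: js) p with hY
    obtain ⟨i, hi⟩ := exists_iterate_empty_eq_lfp (innerHom j (nested A G R js) p Y)
    have hYe : outerHom j (nested A G R js) p Y = Y :=
      (outerHom j (nested A G R js) p).map_gfp
    have hv : v ∈ nested A G R js
        (p.set j Y ((innerHom j (nested A G R js) p Y)^[i] ∅)) := by
      rw [hi]
      change v ∈ innerHom j (nested A G R js) p Y (innerHom j (nested A G R js) p Y).lfp
      rw [OrderHom.map_lfp]
      change v ∈ outerHom j (nested A G R js) p Y
      rwa [hYe]
    obtain ⟨c, hc, hv⟩ := ih hv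
    exact ⟨i :: c, by simp [hc], hv⟩

theorem mem_nested_of_mem_stage {js : List (Fin (k + 1))} {c : List ℕ} {p : Val k V} {v : V}
    (h : v ∈ stage A G R js c p) : v ∈ nested A G R js p := by
  induction js generalizing c p with
  | nil => exact h
  | cons j js ih =>
    match c with
    | [] => exact absurd h (Set.notMem_empty v)
    | i :: c =>
      set Y := nested A G R (j :: js) p with hY
      have hYe : outerHom j (nested A G R js) p Y = Y :=
        (outerHom j (nested A G R js) p).map_gfp
      have h1 := (nested A G R js).monotone (Val.set_mono (le_refl p) j (le_refl Y)
        (iterate_empty_le_lfp (innerHom j (nested A G R js) p Y) i)) (ih h)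
      change v ∈ nested A G R js (p.set j Y (outerHom j (nested A G R js) p Y)) at h1
      rwa [map_outerHom, hYe] at h1

/-- At the counters `c`, the vertices in the current values of the variables have counters that
agree with `c` for the outer variables; those in the current value of an `X` have a smaller counter
for it. -/
theorem exists_val_of_mem_stage [Finite V] {js : List (Fin (k + 1))} {c : List ℕ} {p : Val k V}
    {v : V} (hnd : js.Nodup) (hc : c.length = js.length) (h : v ∈ stage A G R js c p) :
    ∃ q : Val k V, v ∈ chainBody A G R q ∧ (∀ j ∉ js, q.1 j = p.1 j ∧ q.2 j = p.2 j) ∧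
      ∀ (J : ℕ) (hJ : J < js.length),
        (∀ w ∈ q.1 js[J], ∃ c', c'.length = js.length ∧ w ∈ stage A G R js c' p ∧
          c'.take J ≤ c.take J) ∧
        (∀ w ∈ q.2 js[J], ∃ c', c'.length = js.length ∧ w ∈ stage A G R js c' p ∧
          c'.take (J + 1) < c.take (J + 1)) := by
  induction js generalizing c p with
  | nil => exact ⟨p, h, fun _ _ => ⟨rfl, rfl⟩, fun J hJ => absurd hJ (Nat.not_lt_zero J)⟩
  | cons j js ih =>
    match c, hc with
    | i :: c, hc =>
      have hnd' := List.nodup_cons.1 hnd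
      obtain ⟨q, hq, hout, hin⟩ := ih hnd'.2 (by simpa using hc) h
      refine ⟨q, hq, fun j' hj' => ?_, fun J hJ => ?_⟩
      · have hne : j' ≠ j := fun e => hj' (by simp [e])
        have := hout j' fun h => hj' (by simp [h])
        rwa [Val.set_fst_of_ne _ hne, Val.set_snd_of_ne _ hne] at this
      · match J with
        | 0 =>
          have h1 := hout j hnd'.1
          rw [Val.set_fst_self, Val.set_snd_self] at h1
          refine ⟨fun w hw => ?_, fun w hw => ?_⟩
          · rw [List.getElem_cons_zero, h1.1] at hw
            obtain ⟨c', hc', hw⟩ := exists_mem_stage hw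
            exact ⟨c', hc', hw, by simp⟩
          · rw [List.getElem_cons_zero, h1.2] at hw
            match i with
            | 0 => exact absurd hw (Set.notMem_empty w)
            | i + 1 =>
              rw [Function.iterate_succ_apply'] at hw
              obtain ⟨c', hc', hw⟩ := exists_mem_stage hw
              refine ⟨i :: c', by simp [hc'], hw, ?_⟩
              simp [List.cons_lt_cons_iff]
        | J + 1 =>
          obtain ⟨h1, h2⟩ := hin J (by simpa using hJ)
          refine ⟨fun w hw => ?_, fun w hw => ?_⟩
          · obtain ⟨c', hc', hw, hle⟩ := h1 w hw
            refine ⟨i :: c', by simp [hc'], hw, ?_⟩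
            rw [List.take_succ_cons, List.take_succ_cons, cons_le_cons_iff_lex]
            exact Or.inr ⟨rfl, hle⟩
          · obtain ⟨c', hc', hw, hlt⟩ := h2 w hw
            refine ⟨i :: c', by simp [hc'], hw, ?_⟩
            rw [List.take_succ_cons, List.take_succ_cons, List.cons_lt_cons_iff]
            exact Or.inr ⟨rfl, hlt⟩

variable (A G R) in
/-- The rank of a vertex of the chain fixpoint: its least sequence of counters. -/
def rank (v : V) : List ℕ :=
  open Classical in if h : ∃ c, HasConfig A G R v c ∧ ∀ c', HasConfig A G R v c' → c ≤ c'
    then h.choose else []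

theorem mem_chainFixpoint_iff [Finite V] {v : V} :
    v ∈ chainFixpoint A G R ↔ ∃ c, HasConfig A G R v c := by
  constructor
  · intro h
    obtain ⟨c, hc, hv⟩ := exists_mem_stage h
    exact ⟨c, hc.trans length_chainOrder, hv⟩
  · rintro ⟨c, -, hv⟩
    exact mem_nested_of_mem_stage hv

theorem rank_spec [Finite V] {v : V} (hv : v ∈ chainFixpoint A G R) :
    HasConfig A G R v (rank A G R v) ∧
      ∀ c', HasConfig A G R v c' → rank A G R v ≤ c' := by
  have h := exists_least_list (fun c (hc : HasConfig A G R v c) => hc.1)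
    (mem_chainFixpoint_iff.1 hv)
  rw [rank, dif_pos h]
  exact h.choose_spec

/-- At the least counters of `v` some term of the body holds. Vertices of its `Y` can be reached
with the same outer counters, and those of its `X` already at an earlier iterate; their ranks are at
most these counters. -/
theorem rank_step [Finite V] {v : V} (hv : v ∈ chainFixpoint A G R) :
    ∃ J : Fin (k + 1), v ∉ ext R (chainIndex J) ∧ v ∈
      ext G (chainIndex J) ∩ A.cpre {w | w ∈ chainFixpoint A G R ∧
          (rank A G R w).take J ≤ (rank A G R v).take J} ∪
        A.apre {w | w ∈ chainFixpoint A G R ∧ (rank A G R w).take J ≤ (rank A G R v).take J}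
          {w | w ∈ chainFixpoint A G R ∧
            (rank A G R w).take (J + 1) < (rank A G R v).take (J + 1)} := by
  obtain ⟨hc, -⟩ := rank_spec hv
  obtain ⟨q, hq, -, hin⟩ := exists_val_of_mem_stage chainOrder_nodup
    (hc.1.trans length_chainOrder.symm) hc.2
  obtain ⟨j, hjR, hcore⟩ := mem_chainBody.1 hq
  obtain ⟨J, rfl⟩ := chainIndex_surjective j
  obtain ⟨h1, h2⟩ := hin J (length_chainOrder.symm ▸ J.2)
  refine ⟨J, hjR, ?_⟩
  have h1' : q.1 (chainIndex J) ⊆ {w | w ∈ chainFixpoint A G R ∧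
      (rank A G R w).take J ≤ (rank A G R v).take J} := fun w hw => by
    obtain ⟨c', hc', hw', hle⟩ := h1 w hw
    have hcfg : HasConfig A G R w c' := ⟨hc'.trans length_chainOrder, hw'⟩
    have hwZ := mem_chainFixpoint_iff.2 ⟨c', hcfg⟩
    exact ⟨hwZ, (take_le_take ((rank_spec hwZ).2 _ hcfg) _).trans hle⟩
  have h2' : q.2 (chainIndex J) ⊆ {w | w ∈ chainFixpoint A G R ∧
      (rank A G R w).take (J + 1) < (rank A G R v).take (J + 1)} := fun w hw => by
    obtain ⟨c', hc', hw', hlt⟩ := h2 w hw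
    have hcfg : HasConfig A G R w c' := ⟨hc'.trans length_chainOrder, hw'⟩
    have hwZ := mem_chainFixpoint_iff.2 ⟨c', hcfg⟩
    exact ⟨hwZ, (take_le_take ((rank_spec hwZ).2 _ hcfg) _).trans_lt hlt⟩
  exact Set.union_subset_union (Set.inter_subset_inter_right _ (A.cpre_mono h1'))
    (A.apre_mono h1' h2') hcore

/-! ### Extracted strategies win -/

theorem exists_succ_mem_of_mem_chainFixpoint [Finite V] {v : V}
    (hv : v ∈ chainFixpoint A G R) (h0 : v ∈ A.V0) :
    ∃ w, A.E v w ∧ w ∈ chainFixpoint A G R := by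
  obtain ⟨J, -, ⟨-, h⟩ | h | ⟨-, h⟩⟩ := rank_step hv
  · rcases h with ⟨-, w, hw, hZ⟩ | ⟨h1, -⟩
    · exact ⟨w, hw, hZ.1⟩
    · exact absurd h0 h1
  · rcases h with ⟨-, w, hw, hZ⟩ | ⟨h1, -⟩
    · exact ⟨w, hw, hZ.1⟩
    · exact absurd h0 h1
  · exact absurd h0 h.1

theorem exists_extracted [Finite V] (hdead : A.NoDeadEnd) :
    ∃ ρ : A.Strategy A.V0, ρ.Memoryless ∧ Extracted A G R ρ := by
  have key : ∀ v : A.V0, ∃ w, A.E v w ∧ ((v : V) ∈ chainFixpoint A G R →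
      ∃ c, HasConfig A G R w c ∧ ∀ u c', A.E v u → HasConfig A G R u c' → c ≤ c') := by
    intro v
    by_cases hv : (v : V) ∈ chainFixpoint A G R
    · obtain ⟨w, hw, hZ⟩ := exists_succ_mem_of_mem_chainFixpoint hv v.2
      obtain ⟨c, hc⟩ := mem_chainFixpoint_iff.1 hZ
      obtain ⟨c, ⟨w, hw, hc⟩, hmin⟩ := exists_least_list
        (P := fun c => ∃ w, A.E v w ∧ HasConfig A G R w c) (n := k + 1)
        (fun c ⟨_, _, hc⟩ => hc.1) ⟨c, w, hw, hc⟩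
      exact ⟨w, hw, fun _ => ⟨c, hc, fun u c' hu hc' => hmin c' ⟨u, hu, hc'⟩⟩⟩
    · obtain ⟨w, hw⟩ := hdead v
      exact ⟨w, hw, fun h => absurd h hv⟩
  choose f hf using key
  exact ⟨⟨fun _ v => f v, fun _ v => (hf v).1⟩, fun _ _ _ => rfl, fun _ v hv => (hf v).2 hv⟩

/-- A play that is compliant with an extracted strategy moves from a vertex of a controllable
predecessor into the corresponding set, if membership in this set passes to smaller ranks. -/
theorem Extracted.mem_of_cpre [Finite V] {ρ : A.Strategy A.V0} (hρ : Extracted A G R ρ)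
    {ρ₁ : A.Strategy A.V1} {π : ℕ → V} (hπ : A.Compliant ρ ρ₁ π) {i : ℕ} {S : Set V}
    (hi : π i ∈ chainFixpoint A G R) (h : π i ∈ A.cpre S) (hSZ : S ⊆ chainFixpoint A G R)
    (hS : ∀ u w, u ∈ S → w ∈ chainFixpoint A G R → rank A G R w ≤ rank A G R u → w ∈ S) :
    π (i + 1) ∈ S := by
  rcases h with ⟨h0, u, hu, huS⟩ | ⟨h1, hall⟩
  · obtain ⟨c, hc, hmin⟩ := hρ ((List.range i).map π) ⟨π i, h0⟩ hi
    rw [(hπ i).1 h0]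
    have hZ := mem_chainFixpoint_iff.2 ⟨c, hc⟩
    exact hS u _ huS hZ (((rank_spec hZ).2 c hc).trans
      (hmin u _ hu (rank_spec (hSZ huS)).1))
  · refine hall _ ?_
    rw [(hπ i).2 h1]
    exact ρ₁.legal _ ⟨π i, h1⟩

theorem Extracted.next [Finite V] {ρ : A.Strategy A.V0} (hρ : Extracted A G R ρ)
    {ρ₁ : A.Strategy A.V1} {π : ℕ → V} (hπ : A.Compliant ρ ρ₁ π) {i : ℕ} {J : ℕ} {B : Set V}
    (hi : π i ∈ chainFixpoint A G R)
    (hstep : π i ∈ B ∩ A.cpre {w | w ∈ chainFixpoint A G R ∧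
          (rank A G R w).take J ≤ (rank A G R (π i)).take J} ∪
        A.apre {w | w ∈ chainFixpoint A G R ∧ (rank A G R w).take J ≤ (rank A G R (π i)).take J}
          {w | w ∈ chainFixpoint A G R ∧
            (rank A G R w).take (J + 1) < (rank A G R (π i)).take (J + 1)}) :
    π (i + 1) ∈ chainFixpoint A G R ∧
    (rank A G R (π (i + 1))).take J ≤ (rank A G R (π i)).take J ∧
    (π i ∈ B ∨ (rank A G R (π (i + 1))).take (J + 1) < (rank A G R (π i)).take (J + 1) ∨
      ∃ w, A.El (π i) w ∧ w ∈ chainFixpoint A G R ∧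
        (rank A G R w).take (J + 1) < (rank A G R (π i)).take (J + 1)) := by
  rcases hstep with ⟨hB, h⟩ | h | ⟨⟨w, hl, hw⟩, h⟩
  · have := hρ.mem_of_cpre hπ hi h (fun _ h => h.1)
      fun u w hu hw hle => ⟨hw, (take_le_take hle _).trans hu.2⟩
    exact ⟨this.1, this.2, Or.inl hB⟩
  · have := hρ.mem_of_cpre hπ hi h (fun _ h => h.1)
      fun u w hu hw hle => ⟨hw, (take_le_take hle _).trans_lt hu.2⟩
    exact ⟨this.1, take_le_take_of_le J.le_succ (le_of_lt this.2), Or.inr (Or.inl this.2)⟩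
  · have := hρ.mem_of_cpre hπ hi (Or.inr h) (fun _ h => h.1)
      fun u w hu hw hle => ⟨hw, (take_le_take hle _).trans hu.2⟩
    exact ⟨this.1, this.2, Or.inr (Or.inr ⟨w, hl, hw.1, hw.2⟩)⟩

theorem Extracted.winsWith [Finite V] (hR : Antitone R) {ρ : A.Strategy A.V0}
    (hρ : Extracted A G R ρ) {v : V} (hv : v ∈ chainFixpoint A G R) :
    A.WinsWith (A.fairAdversarial (rabin G R)) ρ v := by
  intro ρ₁ π hπ0 hπ hfair
  have hstep : ∀ u : chainFixpoint A G R, _ := fun u => rank_step u.2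
  choose J hJR hJ using hstep
  have hZ : ∀ i, π i ∈ chainFixpoint A G R := by
    intro i
    induction i with
    | zero => rwa [hπ0]
    | succ i ih => exact (hρ.next hπ ih (hJ ⟨π i, ih⟩)).1
  let j : ℕ → Fin (k + 1) := fun i => J ⟨π i, hZ i⟩
  have hj : ∀ i l, π i = π l → j i = j l := fun i l h => by simp only [j, h]
  obtain ⟨N, hN⟩ := eventually_atTop.1 (eventually_frequently_visited π)
  -- The outermost position from `N` on. Its `R` is contained in those of all other positions
  -- occurring there, so it is avoided from `N` on.
  obtain ⟨s, hs, hsmin⟩ := exists_minimalFor_of_wellFoundedLT (fun i => N ≤ i) j ⟨N, le_rfl⟩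
  have hjs : ∀ i, N ≤ i → j s ≤ j i := fun i hi => by
    by_contra h
    exact h (hsmin hi (not_le.1 h).le)
  have hnext : ∀ i, _ := fun i => (hρ.next hπ (hZ i) (hJ ⟨π i, hZ i⟩)).2
  by_cases hG : ∃ i, N ≤ i ∧ j i = j s ∧ π i ∈ ext G (chainIndex (j s))
  · obtain ⟨i, hi, hji, hiG⟩ := hG
    have hne : chainIndex (j s) ≠ 0 := fun h => by
      rw [h] at hiG
      exact hiG
    obtain ⟨m, hm⟩ := Fin.exists_succ_eq.2 hne
    refine ⟨m, eventually_atTop.2 ⟨N, fun l hl hlR => ?_⟩, (hN i hi).mono fun l hl => ?_⟩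
    · refine hJR ⟨π l, hZ l⟩ (ext_chainIndex_mono hR (hjs l hl) ?_)
      rw [← hm]
      exact hlR
    · rw [hl]
      rw [← hm] at hiG
      exact hiG
  · exfalso
    push Not at hG
    let rk : ℕ → List ℕ := fun i => (rank A G R (π i)).take (j s + 1)
    obtain ⟨t, ht, htmin⟩ : ∃ t, N ≤ t ∧ ∀ i, N ≤ i → rk t ≤ rk i := by
      obtain ⟨_, ⟨t, ht, rfl⟩, hmin⟩ := exists_least_list
        (P := fun c => ∃ t, N ≤ t ∧ rk t = c) (n := min (j s + 1) (k + 1))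
        (fun c ⟨t, _, h⟩ => by
          rw [← h, List.length_take, (rank_spec (hZ t)).1.1]) ⟨_, N, le_rfl, rfl⟩
      exact ⟨t, ht, fun i hi => hmin _ ⟨i, hi, rfl⟩⟩
    -- At position `j s` the prefix would drop below its minimum, at once or, by fairness, when the
    -- live edge is taken on a later visit.
    have hgt : ∀ i, N ≤ i → rk i = rk t → j i ≠ j s := by
      intro i hi hit hji
      obtain ⟨-, h | h | ⟨w, hl, -, hlt⟩⟩ := hnext i
      · exact hG i hi hji (hji ▸ h)
      · change _ < ((rank A G R (π i)).take (j i + 1)) at h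
        change ((rank A G R (π (i + 1))).take (j i + 1)) < _ at h
        rw [hji] at h
        exact (htmin (i + 1) (by omega)).not_gt (hit ▸ h)
      · change ((rank A G R w).take (j i + 1)) < ((rank A G R (π i)).take (j i + 1)) at hlt
        rw [hji] at hlt
        obtain ⟨l, hl, hl'⟩ := (frequently_atTop.1 (hfair _ _ hl (hN i hi))) N
        have := htmin (l + 1) (by omega)
        simp only [rk, hl'.2] at this
        exact this.not_gt (hlt.trans_eq hit)
    -- Positions strictly inside `j s` do not increase the first `j s + 1` counters, so the minimum
    -- persists.
    have hall : ∀ i, t ≤ i → rk i = rk t := by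
      intro i hi
      induction i, hi using Nat.le_induction with
      | base => rfl
      | succ i hi ih =>
        have hlt : j s < j i := lt_of_le_of_ne (hjs i (by omega)) (hgt i (by omega) ih).symm
        have h := (hnext i).1
        refine le_antisymm ((take_le_take_of_le ?_ h).trans_eq ih) (htmin _ (by omega))
        exact hlt
    obtain ⟨l, hl, hls⟩ := frequently_atTop.1 (hN s hs) (max t N)
    exact hgt l (by omega) (hall l (by omega)) (hj l s hls)

end Rank

/-! ### Scheduling of live edges -/

section Schedule

/-- The state of a play in which player 1 schedules live edges: the past, the current vertex, the
set of the vertices at which a live edge is due, and the number of scheduled moves per vertex. -/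
structure ScheduleState (V : Type*) where
  past : List V
  cur : V
  due : Set V
  count : V → ℕ

variable (A : LiveGame V) (ρ₀ : A.Strategy A.V0) (s : V → V) (D : V → Set V) (g : ℕ → V)

open Classical in
/-- Player 1 moves along `s`, or along the next live edge if one is due.  After a scheduled move
from `v`, a live edge of `v` becomes due again when `D v` is visited. -/
def ScheduleState.next (x : ScheduleState V) : ScheduleState V where
  past := x.past ++ [x.cur]
  cur := if h : x.cur ∈ A.V0 then ρ₀.move x.past ⟨x.cur, h⟩
    else if x.cur ∈ x.due ∧ A.El x.cur (g (x.count x.cur)) then g (x.count x.cur) else s x.cur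
  due := {u | x.cur ∈ D u ∨ u ∈ x.due ∧ u ≠ x.cur}
  count u := if u = x.cur ∧ u ∈ x.due then x.count u + 1 else x.count u

/-- The states of the play from `v`. -/
def schedule (v : V) : ℕ → ScheduleState V
  | 0 => ⟨[], v, ∅, fun _ => 0⟩
  | i + 1 => (schedule v i).next A ρ₀ s D g

/-- The play from `v`. -/
def scheduledPlay (v : V) (i : ℕ) : V := (schedule A ρ₀ s D g v i).cur

variable {A ρ₀ s D g} {v : V}

theorem schedule_past (i : ℕ) :
    (schedule A ρ₀ s D g v i).past = (List.range i).map (scheduledPlay A ρ₀ s D g v) := by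
  induction i with
  | zero => rfl
  | succ i ih =>
    rw [List.range_succ, List.map_append, ← ih]
    rfl

theorem scheduledPlay_of_mem (i : ℕ) (h : scheduledPlay A ρ₀ s D g v i ∈ A.V0) :
    scheduledPlay A ρ₀ s D g v (i + 1) =
      ρ₀.move ((List.range i).map (scheduledPlay A ρ₀ s D g v)) ⟨_, h⟩ := by
  rw [← schedule_past]
  exact dif_pos h

theorem scheduledPlay_of_notMem (i : ℕ) (h : scheduledPlay A ρ₀ s D g v i ∉ A.V0) :
    scheduledPlay A ρ₀ s D g v (i + 1) = s (scheduledPlay A ρ₀ s D g v i) ∨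
      scheduledPlay A ρ₀ s D g v i ∈ (schedule A ρ₀ s D g v i).due ∧
      A.El (scheduledPlay A ρ₀ s D g v i) (scheduledPlay A ρ₀ s D g v (i + 1)) := by
  have h1 : scheduledPlay A ρ₀ s D g v (i + 1) = _ := dif_neg h
  split_ifs at h1 with h2
  · rw [h1]
    exact Or.inr h2
  · exact Or.inl h1

theorem exists_visited_of_due {i : ℕ} {u : V} (h : u ∈ (schedule A ρ₀ s D g v i).due) :
    ∃ l, scheduledPlay A ρ₀ s D g v l ∈ D u := by
  induction i with
  | zero => exact absurd h (Set.notMem_empty u)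
  | succ i ih =>
    rcases h with h | h
    · exact ⟨i, h⟩
    · exact ih h.1

/-- Once `D u` is no longer visited, the next move from `u` clears its mark for good. -/
theorem eventually_not_due {u : V}
    (h : ∀ᶠ i in atTop, scheduledPlay A ρ₀ s D g v i ∉ D u) :
    ∀ᶠ i in atTop, scheduledPlay A ρ₀ s D g v i = u → u ∉ (schedule A ρ₀ s D g v i).due := by
  obtain ⟨N, hN⟩ := eventually_atTop.1 h
  by_cases ht : ∃ t, N ≤ t ∧ scheduledPlay A ρ₀ s D g v t = u
  · obtain ⟨t, ht, htu⟩ := ht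
    suffices H : ∀ i, t + 1 ≤ i → u ∉ (schedule A ρ₀ s D g v i).due from
      eventually_atTop.2 ⟨t + 1, fun i hi _ => H i hi⟩
    intro i hi
    induction i, hi using Nat.le_induction with
    | base =>
      rintro (h | h)
      · exact hN t ht h
      · exact h.2 htu.symm
    | succ i hi ih =>
      rintro (h | h)
      · exact hN i (by omega) h
      · exact ih h.1
  · push Not at ht
    exact eventually_atTop.2 ⟨N, fun i hi h => absurd h (ht i hi)⟩

/-- The number of scheduled moves from `u` is unbounded and grows by one each time, so it hits each
of the infinitely many `n` with `g n = w`. -/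
theorem frequently_scheduled (hg : ∀ w, ∃ᶠ n in atTop, g n = w) {u w : V} (hu : A.El u w)
    (h1 : ∃ᶠ i in atTop, scheduledPlay A ρ₀ s D g v i = u)
    (h2 : ∃ᶠ i in atTop, scheduledPlay A ρ₀ s D g v i ∈ D u) :
    ∃ᶠ i in atTop, scheduledPlay A ρ₀ s D g v i = u ∧
      scheduledPlay A ρ₀ s D g v (i + 1) = w := by
  set π := scheduledPlay A ρ₀ s D g v
  let F : ℕ → Prop := fun i => u ∈ (schedule A ρ₀ s D g v i).due
  let C : ℕ → ℕ := fun i => (schedule A ρ₀ s D g v i).count u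
  have hC1 : ∀ i, u = π i ∧ F i → C (i + 1) = C i + 1 := fun i h => if_pos h
  have hC0 : ∀ i, ¬(u = π i ∧ F i) → C (i + 1) = C i := fun i h => if_neg h
  have hmono : Monotone C := monotone_nat_of_le_succ fun i => by
    by_cases h : u = π i ∧ F i
    · rw [hC1 i h]; omega
    · rw [hC0 i h]
  have hunb : ∀ i, ∃ m, C i < C m := by
    intro i
    by_contra! hcon
    have hconst : ∀ m, i ≤ m → C m = C i := fun m hm => le_antisymm (hcon m) (hmono hm)
    obtain ⟨l, hl, hlD⟩ := frequently_atTop.1 h2 i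
    have hF : ∀ m, l + 1 ≤ m → F m := by
      intro m hm
      induction m, hm using Nat.le_induction with
      | base => exact Or.inl hlD
      | succ m hm ih =>
        refine Or.inr ⟨ih, fun h => ?_⟩
        have := hC1 m ⟨h, ih⟩
        rw [hconst m (by omega), hconst (m + 1) (by omega)] at this
        omega
    obtain ⟨t, ht, htu⟩ := frequently_atTop.1 h1 (l + 1)
    have := hC1 t ⟨htu.symm, hF t ht⟩
    rw [hconst t (by omega), hconst (t + 1) (by omega)] at this
    omega
  have hunb' : ∀ n, ∃ m, n ≤ C m := by
    intro n
    induction n with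
    | zero => exact ⟨0, Nat.zero_le _⟩
    | succ n ih =>
      obtain ⟨m, hm⟩ := ih
      obtain ⟨m', hm'⟩ := hunb m
      exact ⟨m', by omega⟩
  classical
  refine frequently_atTop.2 fun i => ?_
  obtain ⟨n, hn, hgn⟩ := frequently_atTop.1 (hg w) (C i)
  have hex := hunb' (n + 1)
  have hspec := Nat.find_spec hex
  have hlt : i < Nat.find hex := by
    by_contra! h
    have := hmono h
    omega
  -- The counter first exceeds `n` at time `t + 1`, so the move at time `t` is the scheduled one
  -- with number `n`.
  obtain ⟨t, ht⟩ : ∃ t, Nat.find hex = t + 1 := ⟨Nat.find hex - 1, by omega⟩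
  have hCt : C t ≤ n := by
    have := Nat.find_min hex (m := t) (by omega)
    omega
  rw [ht] at hspec
  have hstep : u = π t ∧ F t := by
    by_contra h
    rw [hC0 t h] at hspec
    omega
  have hCn : C t = n := by
    rw [hC1 t hstep] at hspec
    omega
  refine ⟨t, by omega, hstep.1.symm, ?_⟩
  have hV : π t ∉ A.V0 := hstep.1 ▸ A.El_owner _ _ hu
  have h1 : π (t + 1) = _ := dif_neg hV
  have hgt : g ((schedule A ρ₀ s D g v t).count (schedule A ρ₀ s D g v t).cur) = w := by
    have : (schedule A ρ₀ s D g v t).cur = u := hstep.1.symm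
    rw [this, ← hgn, ← hCn]
  rw [h1, hgt]
  refine if_pos ⟨?_, ?_⟩
  · change π t ∈ _
    rw [← hstep.1]
    exact hstep.2
  · change A.El (π t) w
    rw [← hstep.1]
    exact hu

theorem exists_frequently_eq [Finite V] [Nonempty V] :
    ∃ g : ℕ → V, ∀ w, ∃ᶠ n in atTop, g n = w := by
  obtain ⟨f, hf⟩ := exists_surjective_nat V
  refine ⟨fun n => f n.unpair.1, fun w => frequently_atTop.2 fun i => ?_⟩
  obtain ⟨m, rfl⟩ := hf w
  exact ⟨Nat.pair m i, Nat.right_le_pair m i, by simp⟩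

/-- A sequence that starts in `v`, follows the strategy of player 0 and otherwise only edges, is
compliant with a strategy of player 1. -/
theorem exists_compliant (hdead : A.NoDeadEnd) {π : ℕ → V}
    (h0 : ∀ i, ∀ h : π i ∈ A.V0, π (i + 1) = ρ₀.move ((List.range i).map π) ⟨π i, h⟩)
    (h1 : ∀ i, A.E (π i) (π (i + 1))) :
    ∃ ρ₁ : A.Strategy A.V1, A.Compliant ρ₀ ρ₁ π := by
  classical
  choose f hf using hdead
  refine ⟨⟨fun w v => if A.E v (π (w.length + 1)) then π (w.length + 1) else f v,
    fun w v => ?_⟩, fun i => ⟨h0 i, fun h => ?_⟩⟩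
  · split_ifs with h
    · exact h
    · exact hf v
  · simp [h1 i]

end Schedule

/-! ### Ranks outside the chain fixpoint -/

theorem take_lt_take_of_le {a b : List ℕ} {l m : ℕ} (hlm : l ≤ m) (h : a.take l < b.take l) :
    a.take m < b.take m :=
  not_le.1 fun h' => h.not_ge (take_le_take_of_le hlm h')

theorem eventually_eq_of_eventually_le {f : ℕ → List ℕ} {n : ℕ} (hn : ∀ i, (f i).length = n)
    (h : ∀ᶠ i in atTop, f (i + 1) ≤ f i) : ∀ᶠ i in atTop, f (i + 1) = f i := by
  obtain ⟨N, hN⟩ := eventually_atTop.1 h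
  obtain ⟨_, ⟨t, ht, rfl⟩, hmin⟩ := exists_least_list (P := fun c => ∃ t, N ≤ t ∧ f t = c) (n := n)
    (fun c ⟨t, _, h⟩ => h ▸ hn t) ⟨_, N, le_rfl, rfl⟩
  have hconst : ∀ i, t ≤ i → f i = f t := by
    intro i hi
    induction i, hi using Nat.le_induction with
    | base => rfl
    | succ i hi ih =>
      exact le_antisymm ((hN i (by omega)).trans_eq ih) (hmin _ ⟨i + 1, by omega, rfl⟩)
  exact eventually_atTop.2 ⟨t, fun i hi => by rw [hconst i hi, hconst (i + 1) (by omega)]⟩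

section Corank

theorem iterate_univ_anti (F : Set V →o Set V) : Antitone fun i => F^[i] Set.univ :=
  F.monotone.antitone_iterate_of_map_le (Set.subset_univ _)

theorem gfp_le_iterate_univ (F : Set V →o Set V) (i : ℕ) : F.gfp ≤ F^[i] Set.univ := by
  induction i with
  | zero => exact Set.subset_univ _
  | succ i ih =>
    rw [Function.iterate_succ_apply', ← F.map_gfp]
    exact F.monotone ih

theorem exists_iterate_univ_eq_gfp [Finite V] (F : Set V →o Set V) :
    ∃ i, F^[i] Set.univ = F.gfp := by
  obtain ⟨n, hn⟩ := WellFoundedGT.monotone_chain_condition (α := (Set V)ᵒᵈ)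
    ⟨fun i => OrderDual.toDual (F^[i] Set.univ), iterate_univ_anti F⟩
  refine ⟨n, le_antisymm (F.le_gfp (le_of_eq ?_)) (gfp_le_iterate_univ F n)⟩
  rw [← Function.iterate_succ_apply' F]
  exact hn (n + 1) n.le_succ

variable (A : LiveGame V) (G R : Fin k → Set V)

/-- The body of `ν Y_{j₁}. μ X_{j₁}. ν Y_{j₂}. μ X_{j₂}. … (chain body)` at the counters
`i₁, i₂, …` of the `ν`-iterations from the set of all vertices: `Y` is the iterate with the given
number, and `X` is its successor. -/
def costage : List (Fin (k + 1)) → List ℕ → Val k V → Set V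
  | [], _, p => chainBody A G R p
  | _ :: _, [], _ => Set.univ
  | j :: js, i :: c, p =>
    costage js c (p.set j ((outerHom j (nested A G R js) p)^[i] Set.univ)
      ((outerHom j (nested A G R js) p)^[i + 1] Set.univ))

variable {A G R}

/-- The next `ν`-iterate is the least fixpoint `X` for the current `Y`, so unfolding it once gives
it back. -/
theorem notMem_nested_of_notMem_iterate {j : Fin (k + 1)} {js : List (Fin (k + 1))} {p : Val k V}
    {v : V} {i : ℕ} (h : v ∉ (outerHom j (nested A G R js) p)^[i + 1] Set.univ) :
    v ∉ nested A G R js (p.set j ((outerHom j (nested A G R js) p)^[i] Set.univ)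
      ((outerHom j (nested A G R js) p)^[i + 1] Set.univ)) := by
  rw [Function.iterate_succ_apply'] at h ⊢
  rwa [map_outerHom]

theorem exists_notMem_costage [Finite V] {js : List (Fin (k + 1))} {p : Val k V} {v : V}
    (h : v ∉ nested A G R js p) : ∃ c, c.length = js.length ∧ v ∉ costage A G R js c p := by
  induction js generalizing p with
  | nil => exact ⟨[], rfl, h⟩
  | cons j js ih =>
    obtain ⟨i, hi⟩ := exists_iterate_univ_eq_gfp (outerHom j (nested A G R js) p)
    have hv : v ∉ (outerHom j (nested A G R js) p)^[i] Set.univ := by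
      rw [hi]
      exact h
    match i with
    | 0 => exact absurd (Set.mem_univ v) hv
    | i + 1 =>
      obtain ⟨c, hc, hv⟩ := ih (notMem_nested_of_notMem_iterate hv)
      exact ⟨i :: c, by simp [hc], hv⟩

theorem notMem_nested_of_notMem_costage {js : List (Fin (k + 1))} {c : List ℕ} {p : Val k V}
    {v : V} (h : v ∉ costage A G R js c p) : v ∉ nested A G R js p := by
  induction js generalizing c p with
  | nil => exact h
  | cons j js ih =>
    match c with
    | [] => exact absurd (Set.mem_univ v) h
    | i :: c =>
      intro hv
      refine ih h ?_
      change v ∈ nuMu j (nested A G R js) p at hv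
      rw [← map_nuMu] at hv
      exact (nested A G R js).monotone (Val.set_mono le_rfl j (gfp_le_iterate_univ _ _)
        (gfp_le_iterate_univ _ _)) hv

/-- At the counters `c`, the vertices outside the current values of the variables have counters that
are at most those in `c` for the outer variables; those outside the current value of a `Y` have
smaller ones. -/
theorem exists_val_of_notMem_costage [Finite V] {js : List (Fin (k + 1))} {c : List ℕ}
    {p : Val k V} {v : V} (hnd : js.Nodup) (hc : c.length = js.length)
    (h : v ∉ costage A G R js c p) :
    ∃ q : Val k V, v ∉ chainBody A G R q ∧ (∀ j ∉ js, q.1 j = p.1 j ∧ q.2 j = p.2 j) ∧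
      ∀ (J : ℕ) (hJ : J < js.length),
        (∀ w ∉ q.1 js[J], ∃ c', c'.length = js.length ∧ w ∉ costage A G R js c' p ∧
          c'.take (J + 1) < c.take (J + 1)) ∧
        (∀ w ∉ q.2 js[J], ∃ c', c'.length = js.length ∧ w ∉ costage A G R js c' p ∧
          c'.take (J + 1) ≤ c.take (J + 1)) := by
  induction js generalizing c p with
  | nil => exact ⟨p, h, fun _ _ => ⟨rfl, rfl⟩, fun J hJ => absurd hJ (Nat.not_lt_zero J)⟩
  | cons j js ih =>
    match c, hc with
    | i :: c, hc =>
      have hnd' := List.nodup_cons.1 hnd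
      obtain ⟨q, hq, hout, hin⟩ := ih hnd'.2 (by simpa using hc) h
      refine ⟨q, hq, fun j' hj' => ?_, fun J hJ => ?_⟩
      · have hne : j' ≠ j := fun e => hj' (by simp [e])
        have := hout j' fun h => hj' (by simp [h])
        rwa [Val.set_fst_of_ne _ hne, Val.set_snd_of_ne _ hne] at this
      · match J with
        | 0 =>
          have h1 := hout j hnd'.1
          rw [Val.set_fst_self, Val.set_snd_self] at h1
          refine ⟨fun w hw => ?_, fun w hw => ?_⟩
          · rw [List.getElem_cons_zero, h1.1] at hw
            match i with
            | 0 => exact absurd (Set.mem_univ w) hw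
            | i + 1 =>
              obtain ⟨c', hc', hw⟩ := exists_notMem_costage (notMem_nested_of_notMem_iterate hw)
              refine ⟨i :: c', by simp [hc'], hw, ?_⟩
              simp [List.cons_lt_cons_iff]
          · rw [List.getElem_cons_zero, h1.2] at hw
            obtain ⟨c', hc', hw⟩ := exists_notMem_costage (notMem_nested_of_notMem_iterate hw)
            exact ⟨i :: c', by simp [hc'], hw, by simp⟩
        | J + 1 =>
          obtain ⟨h1, h2⟩ := hin J (by simpa using hJ)
          refine ⟨fun w hw => ?_, fun w hw => ?_⟩
          · obtain ⟨c', hc', hw, hlt⟩ := h1 w hw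
            refine ⟨i :: c', by simp [hc'], hw, ?_⟩
            rw [List.take_succ_cons, List.take_succ_cons, List.cons_lt_cons_iff]
            exact Or.inr ⟨rfl, hlt⟩
          · obtain ⟨c', hc', hw, hle⟩ := h2 w hw
            refine ⟨i :: c', by simp [hc'], hw, ?_⟩
            rw [List.take_succ_cons, List.take_succ_cons, cons_le_cons_iff_lex]
            exact Or.inr ⟨rfl, hle⟩

variable (A G R) in
/-- `v` leaves the chain fixpoint at the counters `c`. -/
def HasCoconfig (v : V) (c : List ℕ) : Prop :=
  c.length = k + 1 ∧ v ∉ costage A G R (chainOrder k) c ⊥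

variable (A G R) in
/-- The rank of a vertex outside the chain fixpoint: its least sequence of counters. -/
def corank (v : V) : List ℕ :=
  open Classical in if h : ∃ c, HasCoconfig A G R v c ∧ ∀ c', HasCoconfig A G R v c' → c ≤ c'
    then h.choose else []

theorem notMem_chainFixpoint_iff [Finite V] {v : V} :
    v ∉ chainFixpoint A G R ↔ ∃ c, HasCoconfig A G R v c := by
  constructor
  · intro h
    obtain ⟨c, hc, hv⟩ := exists_notMem_costage h
    exact ⟨c, hc.trans length_chainOrder, hv⟩
  · rintro ⟨c, -, hv⟩
    exact notMem_nested_of_notMem_costage hv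

theorem corank_spec [Finite V] {v : V} (hv : v ∉ chainFixpoint A G R) :
    HasCoconfig A G R v (corank A G R v) ∧
      ∀ c', HasCoconfig A G R v c' → corank A G R v ≤ c' := by
  have h := exists_least_list (fun c (hc : HasCoconfig A G R v c) => hc.1)
    (notMem_chainFixpoint_iff.1 hv)
  rw [corank, dif_pos h]
  exact h.choose_spec

variable (A G R) in
/-- The vertices outside the chain fixpoint with a rank less than that of `v` up to position `J`. -/
def corankLT (J : Fin (k + 1)) (v : V) : Set V :=
  {w | w ∉ chainFixpoint A G R ∧ (corank A G R w).take (J + 1) < (corank A G R v).take (J + 1)}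

variable (A G R) in
/-- The vertices outside the chain fixpoint with a rank at most that of `v` up to position `J`. -/
def corankLE (J : Fin (k + 1)) (v : V) : Set V :=
  {w | w ∉ chainFixpoint A G R ∧ (corank A G R w).take (J + 1) ≤ (corank A G R v).take (J + 1)}

theorem corankLT_subset_corankLE {J : Fin (k + 1)} {v : V} :
    corankLT A G R J v ⊆ corankLE A G R J v :=
  fun _ h => ⟨h.1, le_of_lt h.2⟩

theorem corankLT_mono {J J' : Fin (k + 1)} (h : J ≤ J') {v : V} :
    corankLT A G R J v ⊆ corankLT A G R J' v :=
  fun _ hw => ⟨hw.1, take_lt_take_of_le (Nat.succ_le_succ h) hw.2⟩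

theorem corankLE_anti {J J' : Fin (k + 1)} (h : J ≤ J') {v : V} :
    corankLE A G R J' v ⊆ corankLE A G R J v :=
  fun _ hw => ⟨hw.1, take_le_take_of_le (Nat.succ_le_succ h) hw.2⟩

theorem corank_step [Finite V] {v : V} (hv : v ∉ chainFixpoint A G R) (J : Fin (k + 1))
    (hR : v ∉ ext R (chainIndex J)) :
    v ∉ ext G (chainIndex J) ∩ A.cpre (corankLT A G R J v)ᶜ ∪
      A.apre (corankLT A G R J v)ᶜ (corankLE A G R J v)ᶜ := by
  obtain ⟨hc, -⟩ := corank_spec hv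
  obtain ⟨q, hq, -, hin⟩ := exists_val_of_notMem_costage chainOrder_nodup
    (hc.1.trans length_chainOrder.symm) hc.2
  obtain ⟨h1, h2⟩ := hin J (length_chainOrder.symm ▸ J.2)
  have h1' : (corankLT A G R J v)ᶜ ⊆ q.1 (chainIndex J) := fun w hw => by
    by_contra hwq
    obtain ⟨c', hc', hw', hlt⟩ := h1 w hwq
    have hcfg : HasCoconfig A G R w c' := ⟨hc'.trans length_chainOrder, hw'⟩
    have hwZ := notMem_chainFixpoint_iff.2 ⟨c', hcfg⟩
    exact hw ⟨hwZ, (take_le_take ((corank_spec hwZ).2 _ hcfg) _).trans_lt hlt⟩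
  have h2' : (corankLE A G R J v)ᶜ ⊆ q.2 (chainIndex J) := fun w hw => by
    by_contra hwq
    obtain ⟨c', hc', hw', hle⟩ := h2 w hwq
    have hcfg : HasCoconfig A G R w c' := ⟨hc'.trans length_chainOrder, hw'⟩
    have hwZ := notMem_chainFixpoint_iff.2 ⟨c', hcfg⟩
    exact hw ⟨hwZ, (take_le_take ((corank_spec hwZ).2 _ hcfg) _).trans hle⟩
  exact fun h => hq (mem_chainBody.2 ⟨_, hR,
    Set.union_subset_union (Set.inter_subset_inter_right _ (A.cpre_mono h1'))
      (A.apre_mono h1' h2') h⟩)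

theorem corank_step_player0 [Finite V] {v w : V} (hv : v ∉ chainFixpoint A G R) (h0 : v ∈ A.V0)
    (hw : A.E v w) {J : Fin (k + 1)} (hR : v ∉ ext R (chainIndex J)) :
    w ∈ corankLE A G R J v ∧ (v ∈ ext G (chainIndex J) → w ∈ corankLT A G R J v) := by
  have h := corank_step hv J hR
  refine ⟨?_, fun hG => ?_⟩
  · by_contra hcon
    exact h (Or.inr (Or.inl (Or.inl ⟨h0, w, hw, hcon⟩)))
  · by_contra hcon
    exact h (Or.inl ⟨hG, Or.inl ⟨h0, w, hw, hcon⟩⟩)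

/-- Failure of `Cpre(X)` gives a move that does not increase. In `G`, or if a live edge leads into
`X`, the remaining condition is `E(v) ⊆ Y`, and its failure gives a strict decrease. -/
theorem corank_step_player1 [Finite V] {v : V} (hv : v ∉ chainFixpoint A G R) (h1 : v ∉ A.V0)
    {J : Fin (k + 1)} (hR : v ∉ ext R (chainIndex J)) :
    (∃ w, A.E v w ∧ w ∈ corankLE A G R J v) ∧
    (v ∈ ext G (chainIndex J) ∨ (∃ w, A.El v w ∧ w ∉ corankLE A G R J v) →
      ∃ w, A.E v w ∧ w ∈ corankLT A G R J v) := by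
  have h := corank_step hv J hR
  constructor
  · by_contra! hcon
    exact h (Or.inr (Or.inl (Or.inr ⟨h1, hcon⟩)))
  · rintro (hG | ⟨u, hu, huJ⟩)
    · by_contra! hcon
      exact h (Or.inl ⟨hG, Or.inr ⟨h1, hcon⟩⟩)
    · by_contra! hcon
      exact h (Or.inr (Or.inr ⟨⟨u, hu, huJ⟩, h1, hcon⟩))

/-! ### Player 1 spoils from outside the fixpoint -/

theorem ext_chainIndex_zero : ext R (chainIndex 0) = ∅ := rfl

/-- The default move `s` of player 1 from `v` outside of the chain fixpoint, and the set `D` whose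
visits allow live edges to be taken. -/
theorem exists_default_move [Finite V] (hRanti : Antitone R) {v : V}
    (hv : v ∉ chainFixpoint A G R) (h1 : v ∉ A.V0) :
    ∃ (s : V) (D : Set V), A.E v s ∧ ∀ J, v ∉ ext R (chainIndex J) →
      s ∈ corankLE A G R J v ∧
      (v ∈ ext G (chainIndex J) → s ∈ corankLT A G R J v ∧ D ⊆ ext R (chainIndex J)) ∧
      (∀ w, A.El v w → w ∈ corankLE A G R J v ∨ D ⊆ ext R (chainIndex J)) ∧
      (D = Set.univ ∨ ∃ J, D = ext R (chainIndex J) ∧ v ∉ ext R (chainIndex J) ∧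
        s ∈ corankLT A G R J v) := by
  classical
  by_cases hN : ∃ J, v ∉ ext R (chainIndex J) ∧
      (v ∈ ext G (chainIndex J) ∨ ∃ w, A.El v w ∧ w ∉ corankLE A G R J v)
  -- A strict decrease at the outermost position that needs one is strict at all inner positions and
  -- at most neutral at outer ones; its `R` lies in all inner ones.
  · obtain ⟨J₀, ⟨hR₀, hN₀⟩, hmin⟩ := exists_minimalFor_of_wellFoundedLT
      (fun J => v ∉ ext R (chainIndex J) ∧
        (v ∈ ext G (chainIndex J) ∨ ∃ w, A.El v w ∧ w ∉ corankLE A G R J v)) id hN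
    obtain ⟨s, hs, hlt⟩ := (corank_step_player1 hv h1 hR₀).2 hN₀
    refine ⟨s, ext R (chainIndex J₀), hs, fun J hR => ?_⟩
    have hless : ∀ J, v ∉ ext R (chainIndex J) → J < J₀ → v ∉ ext G (chainIndex J) ∧
        ∀ w, A.El v w → w ∈ corankLE A G R J v := fun J hR hJ => by
      by_contra hcon
      refine absurd (hmin (j := J) ⟨hR, ?_⟩ hJ.le) (not_le.2 hJ)
      by_contra! h
      exact hcon h
    refine ⟨?_, fun hG => ?_, fun w hw => ?_, Or.inr ⟨J₀, rfl, hR₀, hlt⟩⟩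
    · rcases le_total J J₀ with h | h
      · exact corankLE_anti h (corankLT_subset_corankLE hlt)
      · exact corankLT_subset_corankLE (corankLT_mono h hlt)
    · have h : J₀ ≤ J := not_lt.1 fun h => (hless J hR h).1 hG
      exact ⟨corankLT_mono h hlt, ext_chainIndex_mono hRanti h⟩
    · rcases lt_or_ge J J₀ with h | h
      · exact Or.inl ((hless J hR h).2 w hw)
      · exact Or.inr (ext_chainIndex_mono hRanti h)
  · push Not at hN
    -- No strict decrease is needed, so the innermost avoided position decides and live edges are
    -- harmless.
    obtain ⟨J₀, hR₀, hmax⟩ := exists_maximalFor_of_wellFoundedGT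
      (fun J : Fin (k + 1) => v ∉ ext R (chainIndex J)) id
      ⟨0, by rw [ext_chainIndex_zero]; exact Set.notMem_empty v⟩
    obtain ⟨s, hs, hle⟩ := (corank_step_player1 hv h1 hR₀).1
    refine ⟨s, Set.univ, hs, fun J hR => ⟨?_, fun hG => absurd hG (hN J hR).1,
      fun w hw => Or.inl ((hN J hR).2 w hw), Or.inl rfl⟩⟩
    have : J ≤ J₀ := by
      rcases le_total J J₀ with h | h
      · exact h
      · exact hmax hR h
    exact corankLE_anti this hle

/-- Player 0 does not win from outside of the chain fixpoint. -/
theorem winningRegion_subset_chainFixpoint [Finite V] (hdead : A.NoDeadEnd) (hR : Antitone R) :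
    A.winningRegion (A.fairAdversarial (rabin G R)) ⊆ chainFixpoint A G R := by
  classical
  rintro v₀ ⟨ρ₀, hwin⟩
  by_contra hv₀
  have hmove : ∀ v, ∃ (s : V) (D : Set V), v ∉ chainFixpoint A G R → v ∉ A.V0 →
      A.E v s ∧ ∀ J, v ∉ ext R (chainIndex J) →
      s ∈ corankLE A G R J v ∧
      (v ∈ ext G (chainIndex J) → s ∈ corankLT A G R J v ∧ D ⊆ ext R (chainIndex J)) ∧
      (∀ w, A.El v w → w ∈ corankLE A G R J v ∨ D ⊆ ext R (chainIndex J)) ∧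
      (D = Set.univ ∨ ∃ J, D = ext R (chainIndex J) ∧ v ∉ ext R (chainIndex J) ∧
        s ∈ corankLT A G R J v) := by
    intro v
    by_cases h : v ∉ chainFixpoint A G R ∧ v ∉ A.V0
    · obtain ⟨s, D, h'⟩ := exists_default_move hR h.1 h.2
      exact ⟨s, D, fun _ _ => h'⟩
    · exact ⟨v, ∅, fun h1 h2 => absurd ⟨h1, h2⟩ h⟩
  choose s D hsD using hmove
  have : Nonempty V := ⟨v₀⟩
  obtain ⟨g, hg⟩ := exists_frequently_eq (V := V)
  set π := scheduledPlay A ρ₀ s D g v₀ with hπ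
  let due : ℕ → Set V := fun i => (schedule A ρ₀ s D g v₀ i).due
  have hR0 : ∀ v, v ∉ ext R (chainIndex (0 : Fin (k + 1))) := fun v => by
    rw [ext_chainIndex_zero]; exact Set.notMem_empty v
  have hE0 : ∀ i, π i ∈ A.V0 → A.E (π i) (π (i + 1)) := fun i h => by
    rw [hπ, scheduledPlay_of_mem i h]
    exact ρ₀.legal _ ⟨_, h⟩
  have hZ : ∀ i, π i ∉ chainFixpoint A G R := by
    intro i
    induction i with
    | zero => exact hv₀
    | succ i ih =>
      by_cases h0 : π i ∈ A.V0
      · exact (corank_step_player0 ih h0 (hE0 i h0) (hR0 _)).1.1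
      · obtain ⟨-, h⟩ := hsD (π i) ih h0
        rcases scheduledPlay_of_notMem i h0 with hs | ⟨hdue, hl⟩
        · rw [hπ, hs]
          exact (h 0 (hR0 _)).1.1
        · rcases (h 0 (hR0 _)).2.2.1 _ hl with hle | hD
          · exact hle.1
          -- Position `0` has `R = ∅`, so a live edge that might leave the region is never due.
          · obtain ⟨l, hl⟩ := exists_visited_of_due hdue
            exact absurd (hD hl) (hR0 _)
  have hE : ∀ i, A.E (π i) (π (i + 1)) := by
    intro i
    by_cases h0 : π i ∈ A.V0
    · exact hE0 i h0
    · rcases scheduledPlay_of_notMem i h0 with hs | ⟨-, hl⟩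
      · rw [hπ, hs]
        exact (hsD (π i) (hZ i) h0).1
      · exact A.El_edge _ _ hl
  -- If `R_J` is visited only finitely often, then live edges that depend on it are not taken.
  have hnodue : ∀ J, (∀ᶠ i in atTop, π i ∉ ext R (chainIndex J)) →
      ∀ᶠ i in atTop, D (π i) ⊆ ext R (chainIndex J) → π i ∉ due i := by
    intro J hJ
    have : ∀ᶠ i in atTop, ∀ v, D v ⊆ ext R (chainIndex J) → π i = v → v ∉ due i := by
      refine eventually_all.2 fun v => ?_
      by_cases hD : D v ⊆ ext R (chainIndex J)
      · filter_upwards [eventually_not_due (hJ.mono fun i hi h => hi (hD h))] with i hi _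
        exact hi
      · exact Eventually.of_forall fun _ h => absurd h hD
    exact this.mono fun i hi hD => hi _ hD rfl
  have hle : ∀ J, (∀ᶠ i in atTop, π i ∉ ext R (chainIndex J)) →
      ∀ᶠ i in atTop, π (i + 1) ∈ corankLE A G R J (π i) := by
    intro J hJ
    filter_upwards [hJ, hnodue J hJ] with i hi hdue
    by_cases h0 : π i ∈ A.V0
    · exact (corank_step_player0 (hZ i) h0 (hE i) hi).1
    · have h := (hsD (π i) (hZ i) h0).2 J hi
      rcases scheduledPlay_of_notMem i h0 with hs | ⟨hd, hl⟩
      · rw [hπ, hs]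
        exact h.1
      · exact (h.2.2.1 _ hl).resolve_right fun hD => hdue hD hd
  have hnlt : ∀ J, (∀ᶠ i in atTop, π i ∉ ext R (chainIndex J)) →
      ∀ᶠ i in atTop, π (i + 1) ∉ corankLT A G R J (π i) := by
    intro J hJ
    have := eventually_eq_of_eventually_le
      (f := fun i => (corank A G R (π i)).take (J + 1)) (n := min (J + 1) (k + 1))
      (fun i => by rw [List.length_take, (corank_spec (hZ i)).1.1])
      ((hle J hJ).mono fun i hi => hi.2)
    filter_upwards [this] with i hi h
    exact h.2.ne hi
  obtain ⟨ρ₁, hρ₁⟩ := exists_compliant hdead (ρ₀ := ρ₀) (π := π)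
    (fun i h => scheduledPlay_of_mem i h) hE
  obtain ⟨m, hmR, hmG⟩ := hwin ρ₁ π rfl hρ₁ (by
    intro v w hl hv
    have h1 : v ∉ A.V0 := A.El_owner v w hl
    refine frequently_scheduled hg hl hv ?_
    obtain ⟨l, rfl⟩ := hv.exists
    -- If `D v` is some `R_J` visited finitely often, the default move is eventually taken at each
    -- visit to `v` and strictly decreases a prefix that is eventually constant.
    rcases ((hsD (π l) (hZ l) h1).2 0 (hR0 _)).2.2.2 with hD | ⟨J, hD, -, hlt⟩
    · rw [hD]
      exact Frequently.of_forall fun _ => Set.mem_univ _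
    · intro hcon
      rw [hD] at hcon
      have hJ : ∀ᶠ i in atTop, π i ∉ ext R (chainIndex J) := hcon
      obtain ⟨i, hi, hnl, hdue⟩ := (hv.and_eventually ((hnlt J hJ).and (hnodue J hJ))).exists
      have h0 : π i ∉ A.V0 := hi ▸ h1
      rcases scheduledPlay_of_notMem i h0 with hs | ⟨hd, -⟩
      · refine hnl ?_
        rw [hπ, hs, ← hπ, hi]
        exact hlt
      · exact hdue (by rw [hi, hD]) hd)
  obtain ⟨J, hJ⟩ := chainIndex_surjective m.succ
  have hmR' : ∀ᶠ i in atTop, π i ∉ ext R (chainIndex J) := by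
    rw [hJ]
    exact hmR
  -- A late visit to `G` of the supposedly winning pair would again strictly decrease an eventually
  -- constant prefix.
  obtain ⟨i, hiG, hnl, hdue, hiR⟩ :=
    (hmG.and_eventually ((hnlt J hmR').and ((hnodue J hmR').and hmR'))).exists
  have hiG' : π i ∈ ext G (chainIndex J) := by
    rw [hJ]
    exact hiG
  by_cases h0 : π i ∈ A.V0
  · exact hnl ((corank_step_player0 (hZ i) h0 (hE i) hiR).2 hiG')
  · have h := ((hsD (π i) (hZ i) h0).2 J hiR).2.1 hiG'
    rcases scheduledPlay_of_notMem i h0 with hs | ⟨hd, -⟩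
    · refine hnl ?_
      rw [hπ, hs]
      exact h.1
    · exact hdue h.2 hd

end Corank

end FairGame

end

open FairGame in
theorem mainTheorem5 (k : ℕ) :
    ∃ C : ℕ, ∀ (V : Type*) [Fintype V] (A : LiveGame V) (G R : Fin k → Set V),
      A.NoDeadEnd → Antitone G → Antitone R →
        rabinFixpoint A G R = chainFixpoint A G R ∧
        chainFixpoint A G R = A.winningRegion (A.fairAdversarial (rabin G R)) ∧
        (algorithm A G R).1 = chainFixpoint A G R ∧
        (Nonempty V → (algorithm A G R).2 ≤ C * Fintype.card V ^ (k + 2)) ∧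
        (∃ ρ : A.Strategy A.V0, ρ.Memoryless ∧ Extracted A G R ρ) ∧
        ∀ ρ : A.Strategy A.V0, ρ.Memoryless → Extracted A G R ρ →
          ∀ v ∈ chainFixpoint A G R, A.WinsWith (A.fairAdversarial (rabin G R)) ρ v := by
  refine ⟨(k + 2) * 4 ^ (k + 1) * (11 * (k + 1) + 1), fun V _ A G R hdead hG hR => ?_⟩
  obtain ⟨ρ, hm, hρ⟩ := exists_extracted (G := G) (R := R) hdead
  exact ⟨rabinFixpoint_eq_chainFixpoint hG hR,
    Set.Subset.antisymm (fun v hv => ⟨ρ, hρ.winsWith hR hv⟩)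
      (winningRegion_subset_chainFixpoint hdead hR),
    algorithm_fst, fun _ => algorithm_snd_le, ⟨ρ, hm, hρ⟩,
    fun ρ _ hρ v hv => hρ.winsWith hR hv⟩
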